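/- Let $n\ge 1$, let $\mathbb B$ be the open unit ball of $\mathbb C^n$, and let $dV$ be Lebesgue measure on $\mathbb B$ normalized by $V(\mathbb B)=1$. A radial weight is a positive, measurable, integrable function $\omega$ on $[0,1)$, extended to $\mathbb B$ by $\omega(z)=\omega(|z|)$; write $\hat\omega(r)=\int_r^1\omega(t)\,dt$ and $\omega(E)=\int_E\omega\,dV$ for measurable $E\subset\mathbb B$. Write $\omega\in\mathcal D$ if $\omega$ is a radial weight such that (a) there is $C>0$ with $\hat\omega(r)<C\,\hat\omega\left(\frac{1+r}{2}\right)$ for all $0\le r<1$, and (b) there are $K>1$ and $C>1$ with $\hat\omega(r)\ge C\,\hat\omega\left(1-\frac{1-r}{K}\right)$ for all $r\in(0,1)$. For $\omega\in\mathcal D$ let $K_\omega$ be the infimum of all $K>1$ for which (b) holds with some $C>1$. A radial weight $\omega$ is regular if there are $C>0$ and $\delta\in(0,1)$ with $\frac1C<\frac{\hat\omega(r)}{(1-r)\omega(r)}<C$ for all $r\in(\delta,1)$. For $z\in\mathbb B$ let $P_z$ be the orthogonal projection of $\mathbb C^n$ onto the span of $z$ (so $P_0=0$) and $P_z^\perp=I-P_z$.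 For $z,w\in\mathbb B$ and $0<r<1$ put $$\rho(z,w)=\left|\frac{z-P_z(w)-\sqrt{1-|z|^2}\,P_z^\perp(w)}{1-\langle w,z\rangle}\right|,\qquad \Delta(z,r)=\{w\in\mathbb B:\rho(z,w)<r\}.$$ For $a\in\mathbb B\setminus\{0\}$ let $$S_a=\left\{z\in\mathbb B:\ |a|<|z|<1,\ \left|1-\left\langle \tfrac{a}{|a|},\tfrac{z}{|z|}\right\rangle\right|^{1/2}\le\sqrt{1-|a|}\right\},$$ and let $S_0=\mathbb B$. (1) Let $0<r<1$ and $\omega\in\mathcal D$ with $\frac1{K_\omega}+\frac{2r}{1+r^2}>1$. Then $$\omega(\Delta(z,r))\approx\omega(\Delta(w,r))\approx\omega(S_z)\approx\omega(S_w)\qquad\text{for all } z\in\mathbb B,\ w\in\Delta(z,r),$$ where $A\approx B$ means $A\le CB$ and $B\le CA$ with a constant $C>0$ that may depend on $n$, $\omega$ and $r$ but not on $z$ and $w$. (2) If $\omega$ is regular, then the same comparability holds for every fixed $r\in(0,1)$, with $C$ depending only on $n$, $\omega$ and $r$. -/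

import Mathlib

open MeasureTheory Set

noncomputable section

namespace BallWeights

/-- `ω` is (the radial profile of) a radial weight: positive on `[0, 1)` and Lebesgue integrable
there (`IntegrableOn` contains measurability).  The weight on the ball is `z ↦ ω ‖z‖`. -/
structure IsRadialWeight (ω : ℝ → ℝ) : Prop where
  pos : ∀ t ∈ Ico (0 : ℝ) 1, 0 < ω t
  integrable : IntegrableOn ω (Ico (0 : ℝ) 1) volume

/-- The tail integral `∫_r^1 ω(t) dt`. -/
def tail (ω : ℝ → ℝ) (r : ℝ) : ℝ := ∫ t in r..1, ω t

/-- Doubling weights. -/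
def IsDoubling (ω : ℝ → ℝ) : Prop :=
  IsRadialWeight ω ∧
    ∃ C : ℝ, 0 < C ∧ ∀ r ∈ Ico (0 : ℝ) 1, tail ω r < C * tail ω ((1 + r) / 2)

/-- The constants `K > 1` for which the reverse doubling inequality holds with some `C > 1`. -/
def reverseDoublingConstants (ω : ℝ → ℝ) : Set ℝ :=
  {K | 1 < K ∧ ∃ C : ℝ, 1 < C ∧
    ∀ r ∈ Ioo (0 : ℝ) 1, C * tail ω (1 - (1 - r) / K) ≤ tail ω r}

/-- Reverse doubling weights. -/
def IsReverseDoubling (ω : ℝ → ℝ) : Prop :=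
  IsRadialWeight ω ∧ (reverseDoublingConstants ω).Nonempty

/-- The class of weights that are both doubling and reverse doubling. -/
def IsTwoSidedDoubling (ω : ℝ → ℝ) : Prop :=
  IsDoubling ω ∧ IsReverseDoubling ω

/-- The infimum `K_ω` of the admissible reverse doubling constants. -/
def infReverseDoubling (ω : ℝ → ℝ) : ℝ := sInf (reverseDoublingConstants ω)

/-- Regular weights (no continuity is required). -/
def IsRegularWeight (ω : ℝ → ℝ) : Prop :=
  IsRadialWeight ω ∧
    ∃ C : ℝ, 0 < C ∧ ∃ δ ∈ Ioo (0 : ℝ) 1, ∀ r ∈ Ioo δ 1,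
      1 / C < tail ω r / ((1 - r) * ω r) ∧ tail ω r / ((1 - r) * ω r) < C

/-- `ℂⁿ` with its Hermitian norm. -/
abbrev Cn (n : ℕ) : Type := EuclideanSpace ℂ (Fin n)

/-- The open unit ball of `ℂⁿ`. -/
def unitBall (n : ℕ) : Set (Cn n) := Metric.ball 0 1

/-- Lebesgue measure on the unit ball, normalized to total mass one. -/
def ballMeasure (n : ℕ) : Measure (Cn n) :=
  (volume (unitBall n))⁻¹ • volume.restrict (unitBall n)

/-- The weighted measure `ω(E) = ∫_E ω(|z|) dV(z)`. -/
def weightedMass {n : ℕ} (ω : ℝ → ℝ) (E : Set (Cn n)) : ℝ :=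
  ∫ z in E, ω ‖z‖ ∂(ballMeasure n)

/-- The pseudo-hyperbolic distance.  Mathlib's inner product is conjugate linear in its first
argument, so `⟨w, z⟩ = ∑ w_k conj(z_k)` is `inner ℂ z w`; `P_z` is the orthogonal projection onto
the span of `z`. -/
def pseudoDist {n : ℕ} (z w : Cn n) : ℝ :=
  ‖(1 - inner ℂ z w)⁻¹ •
    (z - (ℂ ∙ z).starProjection w
      - (Real.sqrt (1 - ‖z‖ ^ 2) : ℂ) • (w - (ℂ ∙ z).starProjection w))‖

/-- The pseudo-hyperbolic ball `Δ(z, r)`. -/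
def pseudoBall {n : ℕ} (z : Cn n) (r : ℝ) : Set (Cn n) :=
  {w | w ∈ unitBall n ∧ pseudoDist z w < r}

/-- The nonisotropic distance `|1 - ⟨ξ, τ⟩|^{1/2}`. -/
def nonisoDist {n : ℕ} (ξ τ : Cn n) : ℝ := Real.sqrt ‖1 - inner ℂ τ ξ‖

/-- The nonisotropic ball `Q(ξ, r)` in the unit sphere. -/
def nonisoBall {n : ℕ} (ξ : Cn n) (r : ℝ) : Set (Cn n) :=
  {η | η ∈ Metric.sphere (0 : Cn n) 1 ∧ nonisoDist ξ η ≤ r}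

/-- The unit vector `z / |z|` (used for `z ≠ 0`). -/
def direction {n : ℕ} (z : Cn n) : Cn n := ((‖z‖ : ℂ)⁻¹) • z

open Classical in
/-- The Carleson block `S_a`; it is the whole ball when `a = 0`. -/
def carlesonBlock {n : ℕ} (a : Cn n) : Set (Cn n) :=
  if a = 0 then unitBall n
  else {z | z ∈ unitBall n ∧ ‖a‖ < ‖z‖ ∧
    direction z ∈ nonisoBall (direction a) (Real.sqrt (1 - ‖a‖))}

/-- `A` and `B` are comparable with constant `C`. -/
def ComparableWith (C A B : ℝ) : Prop := A ≤ C * B ∧ B ≤ C * A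

/-- `ω(Δ(z,r)) ≈ ω(Δ(w,r)) ≈ ω(S_z) ≈ ω(S_w)`, uniformly in `z` in the ball and `w ∈ Δ(z,r)`. -/
def BlocksComparable (n : ℕ) (ω : ℝ → ℝ) (r : ℝ) : Prop :=
  ∃ C : ℝ, 0 < C ∧ ∀ z ∈ unitBall n, ∀ w ∈ pseudoBall z r,
    ComparableWith C (weightedMass ω (pseudoBall z r)) (weightedMass ω (pseudoBall w r)) ∧
    ComparableWith C (weightedMass ω (pseudoBall w r)) (weightedMass ω (carlesonBlock z)) ∧
    ComparableWith C (weightedMass ω (carlesonBlock z)) (weightedMass ω (carlesonBlock w))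

end BallWeights

end

/-!
Let `B(z)` be the product of the surface measure of the nonisotropic cap of size `1 - |z|` around
`z / |z|` and the tail of the weight at `|z|`. In polar coordinates the weighted mass of a cap
times an interval of radii `[a, b)` is, for `a` away from `0`, comparable to the measure of the cap
times the difference of the tails at `a` and `b`. The block `S_z` has this shape up to a change of
radius which doubling absorbs, so its mass is comparable to `B(z)`. The ball `Δ(z, r)` lies in such
a sector with `b = 1`, which gives the upper bound by `B(z)`.

For the lower bound, `w` lies in `Δ(z, r)` exactly when
`|1 - ⟨w, z⟩|² (1 - r²) < (1 - |z|²) (1 - |w|²)`. Near the boundary, and for `w` almost in the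
direction of `z`, this reads `(x + y)² (1 - r²) < 4 x y` with `x = 1 - |z|` and `y = 1 - |w|`, that
is, `y / x` lies strictly between `(1 - r) / (1 + r)` and its inverse. Hence `Δ(z, r)` contains a
sector with `y / x` between `1 / k` and `k` for every `k < (1 + r) / (1 - r)`, and its mass is
comparable to `B(z)` as soon as reverse doubling holds with the constant `k²`. Away from the
boundary compactness suffices.

Finally `B` changes by a bounded factor when `1 - |z|` does and the center of the cap moves by
`O(1 - |z|)`, because caps are doubling; on a pair with `w ∈ Δ(z, r)` both conditions hold. Regular
weights satisfy reverse doubling with every constant greater than `1`.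
-/

noncomputable section

namespace BallWeights

open Asymptotics Filter

section InnerProduct

variable {𝕜 E : Type*} [RCLike 𝕜] [NormedAddCommGroup E] [InnerProductSpace 𝕜 E]

theorem norm_one_sub_inner_comm (x y : E) : ‖1 - inner 𝕜 x y‖ = ‖1 - inner 𝕜 y x‖ := by
  rw [← inner_conj_symm x y, ← RCLike.norm_conj, map_sub, map_one, RCLike.conj_conj]

theorem norm_one_sub_inner_sq (x y : E) :
    ‖1 - inner 𝕜 x y‖ ^ 2 = 1 - 2 * RCLike.re (inner 𝕜 x y) + ‖inner 𝕜 x y‖ ^ 2 := by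
  rw [RCLike.norm_sq_eq_def, RCLike.norm_sq_eq_def, map_sub, map_sub, RCLike.one_re, RCLike.one_im]
  ring

theorem one_sub_norm_mul_norm_le (x y : E) : 1 - ‖x‖ * ‖y‖ ≤ ‖1 - inner 𝕜 x y‖ := by
  have hcs := norm_inner_le_norm (𝕜 := 𝕜) x y
  have htri := norm_sub_norm_le (1 : 𝕜) (inner 𝕜 x y)
  rw [norm_one] at htri
  linarith

theorem one_sub_norm_left_le (x : E) {y : E} (hy : ‖y‖ ≤ 1) : 1 - ‖x‖ ≤ ‖1 - inner 𝕜 x y‖ := by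
  have := one_sub_norm_mul_norm_le (𝕜 := 𝕜) x y
  nlinarith [norm_nonneg x]

theorem one_sub_norm_right_le {x : E} (hx : ‖x‖ ≤ 1) (y : E) : 1 - ‖y‖ ≤ ‖1 - inner 𝕜 x y‖ :=
  norm_one_sub_inner_comm (𝕜 := 𝕜) y x ▸ one_sub_norm_left_le y hx

theorem norm_one_sub_inner_pos {x y : E} (hx : ‖x‖ < 1) (hy : ‖y‖ ≤ 1) :
    0 < ‖1 - inner 𝕜 x y‖ :=
  (sub_pos.mpr hx).trans_le (one_sub_norm_left_le x hy)

theorem norm_sub_sq_le_norm_one_sub_inner {x : E} (hx : ‖x‖ ≤ 1) (y : E) :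
    ‖x - y‖ ^ 2 ≤ 2 * ‖1 - inner 𝕜 x y‖ - (1 - ‖y‖ ^ 2) := by
  have hre : 1 - RCLike.re (inner 𝕜 x y) ≤ ‖1 - inner 𝕜 x y‖ := by
    simpa only [map_sub, RCLike.one_re] using RCLike.re_le_norm (1 - inner 𝕜 x y)
  have hexpand := norm_sub_sq (𝕜 := 𝕜) x y
  have : ‖x‖ ^ 2 ≤ 1 := pow_le_one₀ (norm_nonneg x) hx
  linarith

/-- Write `1 - ⟪x, z⟫ = (1 - ⟪x, y⟫) + (1 - ⟪y, z⟫) - (1 - ⟪y, y⟫) - ⟪x - y, z - y⟫`; the last term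
is controlled by `norm_sub_sq_le_norm_one_sub_inner`, whose defect absorbs `1 - ⟪y, y⟫`. -/
theorem norm_one_sub_inner_le {x y z : E} (hx : ‖x‖ ≤ 1) (hy : ‖y‖ ≤ 1) (hz : ‖z‖ ≤ 1) :
    ‖1 - inner 𝕜 x z‖ ≤ 2 * (‖1 - inner 𝕜 x y‖ + ‖1 - inner 𝕜 y z‖) := by
  have hxy := norm_sub_sq_le_norm_one_sub_inner (𝕜 := 𝕜) hx y
  have hzy := norm_sub_sq_le_norm_one_sub_inner (𝕜 := 𝕜) hz y
  rw [norm_one_sub_inner_comm z y] at hzy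
  have hyy : ‖1 - inner 𝕜 y y‖ = 1 - ‖y‖ ^ 2 := by
    rw [inner_self_eq_norm_sq_to_K, ← RCLike.ofReal_pow, ← RCLike.ofReal_one, ← RCLike.ofReal_sub,
      RCLike.norm_ofReal, abs_of_nonneg (sub_nonneg.mpr (pow_le_one₀ (norm_nonneg y) hy))]
  have hdecomp : 1 - inner 𝕜 x z = (1 - inner 𝕜 x y) + (1 - inner 𝕜 y z) - (1 - inner 𝕜 y y)
      - inner 𝕜 (x - y) (z - y) := by
    simp only [inner_sub_left, inner_sub_right]
    ring
  calc ‖1 - inner 𝕜 x z‖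
      ≤ ‖1 - inner 𝕜 x y‖ + ‖1 - inner 𝕜 y z‖ + ‖1 - inner 𝕜 y y‖ + ‖inner 𝕜 (x - y) (z - y)‖ := by
        rw [hdecomp]
        exact (norm_sub_le _ _).trans
          (add_le_add_left ((norm_sub_le _ _).trans (add_le_add_left (norm_add_le _ _) _)) _)
    _ ≤ ‖1 - inner 𝕜 x y‖ + ‖1 - inner 𝕜 y z‖ + (1 - ‖y‖ ^ 2) + ‖x - y‖ * ‖z - y‖ := by
        rw [hyy]
        gcongr
        exact norm_inner_le_norm _ _
    _ ≤ 2 * (‖1 - inner 𝕜 x y‖ + ‖1 - inner 𝕜 y z‖) := by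
        linarith [two_mul_le_add_sq ‖x - y‖ ‖z - y‖]

theorem norm_sub_smul_starProjection_sq {z : E} {c : 𝕜} (hc : ‖c‖ ^ 2 = 1 - ‖z‖ ^ 2) (w : E) :
    ‖z - (𝕜 ∙ z).starProjection w - c • (w - (𝕜 ∙ z).starProjection w)‖ ^ 2
      = ‖1 - inner 𝕜 z w‖ ^ 2 - (1 - ‖z‖ ^ 2) * (1 - ‖w‖ ^ 2) := by
  set p := (𝕜 ∙ z).starProjection w
  have hpmem : p ∈ (𝕜 ∙ z) := Submodule.starProjection_apply_mem _ w
  have horth : w - p ∈ (𝕜 ∙ z)ᗮ := Submodule.sub_starProjection_mem_orthogonal w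
  have hz_orth : inner 𝕜 z (w - p) = 0 := horth z (Submodule.mem_span_singleton_self z)
  have hp_orth : inner 𝕜 p (w - p) = 0 := horth p hpmem
  have hzp : inner 𝕜 z p = inner 𝕜 z w := by
    rw [inner_sub_right] at hz_orth
    exact (sub_eq_zero.mp hz_orth).symm
  have hp_norm : ‖p‖ ^ 2 * ‖z‖ ^ 2 = ‖inner 𝕜 z w‖ ^ 2 := by
    obtain ⟨a, ha⟩ := Submodule.mem_span_singleton.mp hpmem
    rw [← hzp, ← ha, inner_smul_right, norm_mul, norm_smul, inner_self_eq_norm_sq_to_K, norm_pow,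
      RCLike.norm_ofReal, abs_norm]
    ring
  have hw_norm : ‖w‖ ^ 2 = ‖p‖ ^ 2 + ‖w - p‖ ^ 2 := by
    simpa only [add_sub_cancel, ← sq] using
      norm_add_sq_eq_norm_sq_add_norm_sq_of_inner_eq_zero p (w - p) hp_orth
  have hpyth : ‖z - p - c • (w - p)‖ ^ 2 = ‖z - p‖ ^ 2 + ‖c‖ ^ 2 * ‖w - p‖ ^ 2 := by
    have horth' : inner 𝕜 (z - p) (c • (w - p)) = 0 := by
      rw [inner_smul_right, inner_sub_left, hz_orth, hp_orth, sub_zero, mul_zero]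
    rw [norm_sub_sq (𝕜 := 𝕜), horth', norm_smul, map_zero]
    ring
  rw [hpyth, norm_sub_sq (𝕜 := 𝕜), hzp, hc, norm_one_sub_inner_sq]
  linear_combination hp_norm - (1 - ‖z‖ ^ 2) * hw_norm

end InnerProduct

section Normalize

open NormedSpace (normalize)

theorem norm_normalize_le_one {E : Type*} [NormedAddCommGroup E] [NormedSpace ℝ E] (x : E) :
    ‖normalize x‖ ≤ 1 := by
  rcases eq_or_ne x 0 with rfl | hx
  · simp
  · exact (NormedSpace.norm_normalize_eq_one_iff.mpr hx).le

variable {𝕜 E : Type*} [RCLike 𝕜] [NormedAddCommGroup E] [InnerProductSpace 𝕜 E]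
  [NormedSpace ℝ E] [IsScalarTower ℝ 𝕜 E]

theorem inner_eq_ofReal_mul_inner_normalize (x y : E) :
    inner 𝕜 x y = ((‖x‖ * ‖y‖ : ℝ) : 𝕜) * inner 𝕜 (normalize x) (normalize y) := by
  conv_lhs => rw [← NormedSpace.norm_smul_normalize x, ← NormedSpace.norm_smul_normalize y]
  rw [inner_smul_left_eq_smul, inner_smul_right_eq_smul, smul_smul, RCLike.real_smul_eq_coe_mul]

theorem norm_one_sub_inner_normalize_le {x y : E} (hx : ‖x‖ ≤ 1) (hy : ‖y‖ ≤ 1) :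
    ‖1 - inner 𝕜 (normalize x) (normalize y)‖ ≤ 2 * ‖1 - inner 𝕜 x y‖ := by
  have ht : ‖x‖ * ‖y‖ ≤ 1 := mul_le_one₀ hx (norm_nonneg y) hy
  have hu : ‖inner 𝕜 (normalize x) (normalize y)‖ ≤ 1 := (norm_inner_le_norm _ _).trans
    (mul_le_one₀ (norm_normalize_le_one x) (norm_nonneg _) (norm_normalize_le_one y))
  have hsplit : 1 - inner 𝕜 (normalize x) (normalize y) = (1 - inner 𝕜 x y)
      - ((1 - ‖x‖ * ‖y‖ : ℝ) : 𝕜) * inner 𝕜 (normalize x) (normalize y) := by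
    rw [inner_eq_ofReal_mul_inner_normalize x y]
    push_cast
    ring
  calc ‖1 - inner 𝕜 (normalize x) (normalize y)‖
      ≤ ‖1 - inner 𝕜 x y‖ + (1 - ‖x‖ * ‖y‖) * 1 := by
        rw [hsplit]
        refine (norm_sub_le _ _).trans (add_le_add_right ?_ _)
        rw [norm_mul, RCLike.norm_ofReal, abs_of_nonneg (sub_nonneg.mpr ht)]
        gcongr
    _ ≤ 2 * ‖1 - inner 𝕜 x y‖ := by linarith [one_sub_norm_mul_norm_le (𝕜 := 𝕜) x y]

theorem norm_one_sub_inner_le_normalize {x y : E} (hx : ‖x‖ ≤ 1) (hy : ‖y‖ ≤ 1) :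
    ‖1 - inner 𝕜 x y‖ ≤ 1 - ‖x‖ * ‖y‖ + ‖1 - inner 𝕜 (normalize x) (normalize y)‖ := by
  have ht : ‖x‖ * ‖y‖ ≤ 1 := mul_le_one₀ hx (norm_nonneg y) hy
  have hsplit : 1 - inner 𝕜 x y = ((1 - ‖x‖ * ‖y‖ : ℝ) : 𝕜)
      + ((‖x‖ * ‖y‖ : ℝ) : 𝕜) * (1 - inner 𝕜 (normalize x) (normalize y)) := by
    rw [inner_eq_ofReal_mul_inner_normalize x y]
    push_cast
    ring
  rw [hsplit]
  refine (norm_add_le _ _).trans (add_le_add ?_ ?_)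
  · rw [RCLike.norm_ofReal, abs_of_nonneg (sub_nonneg.mpr ht)]
  · rw [norm_mul, RCLike.norm_ofReal, abs_of_nonneg (by positivity)]
    exact mul_le_of_le_one_left (norm_nonneg _) ht

end Normalize

section PseudoBall

open NormedSpace (normalize)

variable {n : ℕ} {z w : Cn n} {r : ℝ}

theorem mem_unitBall : z ∈ unitBall n ↔ ‖z‖ < 1 := mem_ball_zero_iff

theorem direction_eq_normalize (z : Cn n) : direction z = normalize z := by
  rw [direction, ← Complex.ofReal_inv]
  rfl

theorem pseudoDist_nonneg (z w : Cn n) : 0 ≤ pseudoDist z w := norm_nonneg _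

theorem pseudoDist_sq (hz : ‖z‖ ≤ 1) (w : Cn n) :
    pseudoDist z w ^ 2 =
      (‖1 - inner ℂ z w‖ ^ 2 - (1 - ‖z‖ ^ 2) * (1 - ‖w‖ ^ 2)) / ‖1 - inner ℂ z w‖ ^ 2 := by
  have hc : ‖(Real.sqrt (1 - ‖z‖ ^ 2) : ℂ)‖ ^ 2 = 1 - ‖z‖ ^ 2 := by
    rw [Complex.norm_real, Real.norm_eq_abs, sq_abs,
      Real.sq_sqrt (sub_nonneg.mpr (pow_le_one₀ (norm_nonneg z) hz))]
  rw [pseudoDist, norm_smul, norm_inv, mul_pow, inv_pow, ← norm_sub_smul_starProjection_sq hc w,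
    inv_mul_eq_div]

theorem mem_pseudoBall_iff (hr : 0 ≤ r) (hz : z ∈ unitBall n) :
    w ∈ pseudoBall z r ↔ w ∈ unitBall n ∧
      ‖1 - inner ℂ z w‖ ^ 2 * (1 - r ^ 2) < (1 - ‖z‖ ^ 2) * (1 - ‖w‖ ^ 2) := by
  refine and_congr_right fun hw => ?_
  rw [mem_unitBall] at hz hw
  rw [← pow_lt_pow_iff_left₀ (pseudoDist_nonneg z w) hr two_ne_zero, pseudoDist_sq hz.le,
    div_lt_iff₀ (pow_pos (norm_one_sub_inner_pos hz hw.le) 2)]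
  constructor <;> intro h <;> linarith

theorem mem_pseudoBall_comm (hr : 0 ≤ r) (hz : z ∈ unitBall n) (hw : w ∈ unitBall n) :
    w ∈ pseudoBall z r ↔ z ∈ pseudoBall w r := by
  simp only [mem_pseudoBall_iff hr hz, mem_pseudoBall_iff hr hw, hz, hw,
    norm_one_sub_inner_comm w z, mul_comm (1 - ‖w‖ ^ 2)]

theorem norm_one_sub_inner_le_of_mem_pseudoBall (hr : r ∈ Ico (0 : ℝ) 1) (hz : z ∈ unitBall n)
    (hw : w ∈ pseudoBall z r) : ‖1 - inner ℂ z w‖ ≤ 4 / (1 - r ^ 2) * (1 - ‖z‖) := by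
  obtain ⟨hw, hzw⟩ := (mem_pseudoBall_iff hr.1 hz).mp hw
  rw [mem_unitBall] at hz hw
  have hr2 : 0 < 1 - r ^ 2 := by nlinarith [hr.1, hr.2]
  have hpos := norm_one_sub_inner_pos (𝕜 := ℂ) hz hw.le
  have hw_le := one_sub_norm_right_le (𝕜 := ℂ) hz.le w
  rw [div_mul_eq_mul_div, le_div_iff₀ hr2]
  refine le_of_mul_le_mul_left ?_ hpos
  calc ‖1 - inner ℂ z w‖ * (‖1 - inner ℂ z w‖ * (1 - r ^ 2))
      ≤ (1 - ‖z‖ ^ 2) * (1 - ‖w‖ ^ 2) := by linarith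
    _ ≤ (2 * (1 - ‖z‖)) * (2 * (1 - ‖w‖)) := by
        have hle {t : ℝ} (ht : t < 1) : 1 - t ^ 2 ≤ 2 * (1 - t) := by nlinarith
        gcongr
        · nlinarith [norm_nonneg w]
        · exact hle hz
        · exact hle hw
    _ = (1 - ‖w‖) * (4 * (1 - ‖z‖)) := by ring
    _ ≤ ‖1 - inner ℂ z w‖ * (4 * (1 - ‖z‖)) := by gcongr

theorem pseudoDist_le_div (hz : z ∈ unitBall n) (hw : w ∈ unitBall n) :
    pseudoDist z w ≤ ‖z - w‖ / (1 - ‖z‖) := by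
  rw [mem_unitBall] at hz hw
  have hnum : ‖1 - inner ℂ z w‖ ^ 2 - (1 - ‖z‖ ^ 2) * (1 - ‖w‖ ^ 2) ≤ ‖z - w‖ ^ 2 := by
    have := pow_le_pow_left₀ (norm_nonneg _) (norm_inner_le_norm (𝕜 := ℂ) z w) 2
    rw [norm_one_sub_inner_sq, norm_sub_sq (𝕜 := ℂ) z w]
    nlinarith
  have : 0 < 1 - ‖z‖ := sub_pos.mpr hz
  refine (pow_le_pow_iff_left₀ (pseudoDist_nonneg z w) (by positivity) two_ne_zero).mp ?_
  rw [pseudoDist_sq hz.le, div_pow]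
  have := one_sub_norm_left_le (𝕜 := ℂ) z hw.le
  gcongr

theorem ball_subset_pseudoBall (hr : r ∈ Icc (0 : ℝ) 1) (hz : z ∈ unitBall n) :
    Metric.ball z (r * (1 - ‖z‖)) ⊆ pseudoBall z r := by
  intro w hw
  rw [mem_ball_iff_norm'] at hw
  have hz1 : 0 < 1 - ‖z‖ := sub_pos.mpr (mem_unitBall.mp hz)
  have hw1 : w ∈ unitBall n := by
    have := norm_le_norm_add_norm_sub z w
    rw [mem_unitBall]
    nlinarith [hr.2]
  exact ⟨hw1, (pseudoDist_le_div hz hw1).trans_lt ((div_lt_iff₀ hz1).mpr hw)⟩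

end PseudoBall

section Tail

variable {ω : ℝ → ℝ}

theorem IsRadialWeight.intervalIntegrable (hω : IsRadialWeight ω) {a b : ℝ} (ha : 0 ≤ a)
    (hab : a ≤ b) (hb : b ≤ 1) : IntervalIntegrable ω volume a b := by
  rw [intervalIntegrable_iff_integrableOn_Ico_of_le hab]
  exact hω.integrable.mono_set (Ico_subset_Ico ha hb)

theorem IsRadialWeight.tail_sub_tail (hω : IsRadialWeight ω) {a b : ℝ} (ha : 0 ≤ a)
    (hab : a ≤ b) (hb : b ≤ 1) : tail ω a - tail ω b = ∫ t in a..b, ω t := by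
  rw [tail, tail, sub_eq_iff_eq_add]
  exact (intervalIntegral.integral_add_adjacent_intervals (hω.intervalIntegrable ha hab hb)
    (hω.intervalIntegrable (ha.trans hab) hb le_rfl)).symm

theorem IsRadialWeight.strictAntiOn_tail (hω : IsRadialWeight ω) :
    StrictAntiOn (tail ω) (Icc 0 1) := by
  intro a ha b hb hab
  rw [← sub_pos, hω.tail_sub_tail ha.1 hab.le hb.2]
  exact intervalIntegral.intervalIntegral_pos_of_pos_on (hω.intervalIntegrable ha.1 hab.le hb.2)
    (fun t ht => hω.pos t ⟨ha.1.trans ht.1.le, ht.2.trans_le hb.2⟩) hab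

theorem IsRadialWeight.tail_le_tail (hω : IsRadialWeight ω) {a b : ℝ} (ha : 0 ≤ a) (hab : a ≤ b)
    (hb : b ≤ 1) : tail ω b ≤ tail ω a :=
  hω.strictAntiOn_tail.antitoneOn ⟨ha, hab.trans hb⟩ ⟨ha.trans hab, hb⟩ hab

theorem tail_one : tail ω 1 = 0 := intervalIntegral.integral_same

theorem IsRadialWeight.tail_pos (hω : IsRadialWeight ω) {a : ℝ} (ha : a ∈ Ico (0 : ℝ) 1) :
    0 < tail ω a :=
  tail_one.symm.trans_lt
    (hω.strictAntiOn_tail (Ico_subset_Icc_self ha) (right_mem_Icc.mpr zero_le_one) ha.2)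

theorem IsRadialWeight.continuousOn_tail (hω : IsRadialWeight ω) :
    ContinuousOn (tail ω) (Icc 0 1) := by
  rw [← uIcc_of_le zero_le_one]
  refine intervalIntegral.continuousOn_primitive_interval_left ?_
  rw [uIcc_of_le zero_le_one, integrableOn_Icc_iff_integrableOn_Ico]
  exact hω.integrable

theorem IsDoubling.exists_tail_le_of_le_two_pow (hω : IsDoubling ω) (m : ℕ) :
    ∃ C : ℝ, 0 < C ∧ ∀ a ∈ Ico (0 : ℝ) 1, ∀ b ∈ Ico (0 : ℝ) 1, 1 - a ≤ 2 ^ m * (1 - b) →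
      tail ω a ≤ C * tail ω b := by
  obtain ⟨hrad, D, hD, hdoub⟩ := hω
  induction m with
  | zero =>
    refine ⟨1, one_pos, fun a ha b hb hab => ?_⟩
    rw [one_mul]
    exact hrad.tail_le_tail hb.1 (by linarith) ha.2.le
  | succ m ih =>
    obtain ⟨C, hC, ih⟩ := ih
    refine ⟨D * C, mul_pos hD hC, fun a ha b hb hab => ?_⟩
    calc tail ω a ≤ D * tail ω ((1 + a) / 2) := (hdoub a ha).le
      _ ≤ D * (C * tail ω b) := by
        gcongr
        exact ih _ ⟨by linarith [ha.1], by linarith [ha.2]⟩ b hb (by rw [pow_succ] at hab; linarith)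
      _ = D * C * tail ω b := by ring

theorem IsDoubling.tail_isBigO (hω : IsDoubling ω) {ι : Type*} {l : Filter ι} {a b : ι → ℝ}
    (ha : ∀ᶠ i in l, a i ∈ Ico (0 : ℝ) 1) (hb : ∀ᶠ i in l, b i ∈ Ico (0 : ℝ) 1)
    (hab : (fun i => 1 - a i) =O[l] fun i => 1 - b i) :
    (fun i => tail ω (a i)) =O[l] fun i => tail ω (b i) := by
  obtain ⟨A, hA⟩ := hab.bound
  obtain ⟨m, hm⟩ := pow_unbounded_of_one_lt A one_lt_two
  obtain ⟨C, -, hC⟩ := hω.exists_tail_le_of_le_two_pow m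
  refine IsBigO.of_bound C ?_
  filter_upwards [ha, hb, hA] with i hai hbi hi
  rw [Real.norm_of_nonneg (hω.1.tail_pos hai).le, Real.norm_of_nonneg (hω.1.tail_pos hbi).le]
  rw [Real.norm_of_nonneg (sub_nonneg.mpr hai.2.le),
    Real.norm_of_nonneg (sub_nonneg.mpr hbi.2.le)] at hi
  refine hC _ hai _ hbi (hi.trans ?_)
  gcongr
  linarith [hbi.2]

end Tail

section Regular

variable {ω : ℝ → ℝ} {C δ r K : ℝ}

theorem one_sub_div_mem_Ico (hr : r < 1) (hK : 1 ≤ K) : 1 - (1 - r) / K ∈ Ico r 1 := by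
  have hr1 : 0 < 1 - r := sub_pos.mpr hr
  have hle : (1 - r) / K ≤ 1 - r := div_le_self hr1.le hK
  have hpos : 0 < (1 - r) / K := by positivity
  constructor <;> linarith

theorem IsRadialWeight.tail_sub_tail_le_of_density_le (hω : IsRadialWeight ω) (hC : 0 ≤ C)
    (h : ∀ t ∈ Ico r 1, ω t ≤ C * tail ω t / (1 - t)) (hr : r ∈ Ico (0 : ℝ) 1) (hK : 1 ≤ K) :
    tail ω r - tail ω (1 - (1 - r) / K) ≤ C * (K - 1) * tail ω r := by
  obtain ⟨hrs, hs1⟩ := one_sub_div_mem_Ico hr.2 hK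
  set s := 1 - (1 - r) / K with hs
  have hr1 : 0 < 1 - r := sub_pos.mpr hr.2
  calc tail ω r - tail ω s = ∫ t in r..s, ω t := hω.tail_sub_tail hr.1 hrs hs1.le
    _ ≤ ∫ _ in r..s, C * tail ω r / (1 - s) := by
        refine intervalIntegral.integral_mono_on hrs (hω.intervalIntegrable hr.1 hrs hs1.le)
          intervalIntegrable_const fun t ht => (h t ⟨ht.1, ht.2.trans_lt hs1⟩).trans ?_
        have h_tail := hω.tail_le_tail hr.1 ht.1 (ht.2.trans hs1.le)
        have h_pos := hω.tail_pos hr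
        have := ht.2
        have : 0 < 1 - s := sub_pos.mpr hs1
        gcongr
    _ = C * (K - 1) * tail ω r := by
        have hlen : s - r = (1 - 1 / K) * (1 - r) := by rw [hs]; ring
        have hs_sub : 1 - s = (1 - r) / K := sub_sub_cancel _ _
        rw [intervalIntegral.integral_const, smul_eq_mul, hlen, hs_sub]
        field_simp

theorem IsRadialWeight.mul_tail_le_tail_sub_tail_of_le_density (hω : IsRadialWeight ω)
    (hC : 0 < C) (h : ∀ t ∈ Ico r 1, tail ω t / (C * (1 - t)) ≤ ω t) (hr : r ∈ Ico (0 : ℝ) 1)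
    (hK : 1 ≤ K) :
    (1 - 1 / K) / C * tail ω (1 - (1 - r) / K) ≤ tail ω r - tail ω (1 - (1 - r) / K) := by
  obtain ⟨hrs, hs1⟩ := one_sub_div_mem_Ico hr.2 hK
  set s := 1 - (1 - r) / K with hs
  have hr1 : 0 < 1 - r := sub_pos.mpr hr.2
  calc (1 - 1 / K) / C * tail ω s = ∫ _ in r..s, tail ω s / (C * (1 - r)) := by
        have hlen : s - r = (1 - 1 / K) * (1 - r) := by rw [hs]; ring
        rw [intervalIntegral.integral_const, smul_eq_mul, hlen]
        field_simp
    _ ≤ ∫ t in r..s, ω t := by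
        refine intervalIntegral.integral_mono_on hrs intervalIntegrable_const
          (hω.intervalIntegrable hr.1 hrs hs1.le) fun t ht =>
            le_trans ?_ (h t ⟨ht.1, ht.2.trans_lt hs1⟩)
        have h_tail := hω.tail_le_tail (hr.1.trans ht.1) ht.2 hs1.le
        have h_pos := hω.tail_pos ⟨hr.1.trans ht.1, ht.2.trans_lt hs1⟩
        have := ht.1
        have : 0 < 1 - t := by linarith [ht.2]
        gcongr
    _ = tail ω r - tail ω s := (hω.tail_sub_tail hr.1 hrs hs1.le).symm

theorem tail_le_pow_mul_tail (hK : 1 ≤ K) (hC : 0 ≤ C)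
    (h : ∀ r ∈ Ioo δ 1, tail ω r ≤ C * tail ω (1 - (1 - r) / K)) (m : ℕ) :
    ∀ r ∈ Ioo δ 1, tail ω r ≤ C ^ m * tail ω (1 - (1 - r) / K ^ m) := by
  induction m with
  | zero => intro r _; simp
  | succ m ih =>
    intro r hr
    have hs := one_sub_div_mem_Ico hr.2 (one_le_pow₀ hK (n := m))
    have hstep := h (1 - (1 - r) / K ^ m) ⟨hr.1.trans_le hs.1, hs.2⟩
    rw [sub_sub_cancel, div_div, ← pow_succ] at hstep
    calc tail ω r ≤ C ^ m * tail ω (1 - (1 - r) / K ^ m) := ih r hr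
      _ ≤ C ^ m * (C * tail ω (1 - (1 - r) / K ^ (m + 1))) := by gcongr
      _ = C ^ (m + 1) * tail ω (1 - (1 - r) / K ^ (m + 1)) := by ring

theorem IsRadialWeight.isDoubling_of_forall_Ioo (hω : IsRadialWeight ω) (hδ : δ ∈ Ico (0 : ℝ) 1)
    (h : ∀ r ∈ Ioo δ 1, tail ω r ≤ C * tail ω ((1 + r) / 2)) : IsDoubling ω := by
  have h_mid {r : ℝ} (hr : r ∈ Ico (0 : ℝ) 1) : (1 + r) / 2 ∈ Ico (0 : ℝ) 1 :=
    ⟨by linarith [hr.1], by linarith [hr.2]⟩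
  have hδ_pos := hω.tail_pos (h_mid hδ)
  set D := tail ω 0 / tail ω ((1 + δ) / 2)
  have hD : 0 ≤ D := div_nonneg (hω.tail_pos (left_mem_Ico.mpr one_pos)).le hδ_pos.le
  refine ⟨hω, max C D + 1, by linarith [le_max_right C D], fun r hr => ?_⟩
  have hr_pos := hω.tail_pos (h_mid hr)
  suffices tail ω r ≤ max C D * tail ω ((1 + r) / 2) by linarith
  rcases le_or_gt r δ with hrδ | hrδ
  · calc tail ω r ≤ tail ω 0 := hω.tail_le_tail le_rfl hr.1 hr.2.le
      _ = D * tail ω ((1 + δ) / 2) := (div_mul_cancel₀ _ hδ_pos.ne').symm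
      _ ≤ max C D * tail ω ((1 + r) / 2) := by
        gcongr
        · exact le_max_right _ _
        · exact hω.tail_le_tail (h_mid hr).1 (by linarith) (h_mid hδ).2.le
  · calc tail ω r ≤ C * tail ω ((1 + r) / 2) := h r ⟨hrδ, hr.2⟩
      _ ≤ max C D * tail ω ((1 + r) / 2) := by
        gcongr
        exact le_max_left _ _

theorem IsRadialWeight.exists_mul_tail_le_of_le (hω : IsRadialWeight ω) (hδ : δ ∈ Ico (0 : ℝ) 1)
    (hK : 1 < K) :
    ∃ D : ℝ, 1 < D ∧ ∀ r ∈ Icc 0 δ, D * tail ω (1 - (1 - r) / K) ≤ tail ω r := by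
  have hs {r : ℝ} (hr : r ∈ Icc 0 δ) : 1 - (1 - r) / K ∈ Ico (0 : ℝ) 1 :=
    have := one_sub_div_mem_Ico (hr.2.trans_lt hδ.2) hK.le
    ⟨hr.1.trans this.1, this.2⟩
  have hcont : ContinuousOn (fun r => tail ω r / tail ω (1 - (1 - r) / K)) (Icc 0 δ) :=
    (hω.continuousOn_tail.mono (Icc_subset_Icc_right hδ.2.le)).div
      (hω.continuousOn_tail.comp (by fun_prop) fun r hr => Ico_subset_Icc_self (hs hr))
      fun r hr => (hω.tail_pos (hs hr)).ne'
  obtain ⟨r₀, hr₀, hmin⟩ := isCompact_Icc.exists_isMinOn (nonempty_Icc.mpr hδ.1) hcont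
  refine ⟨_, ?_, fun r hr => (le_div_iff₀ (hω.tail_pos (hs hr))).mp (hmin hr)⟩
  have hlt : r₀ < 1 - (1 - r₀) / K := by
    linarith [div_lt_self (sub_pos.mpr (hr₀.2.trans_lt hδ.2)) hK]
  rw [one_lt_div (hω.tail_pos (hs hr₀))]
  exact hω.strictAntiOn_tail ⟨hr₀.1, hr₀.2.trans hδ.2.le⟩ (Ico_subset_Icc_self (hs hr₀)) hlt

theorem IsRadialWeight.mem_reverseDoublingConstants_of_forall_Ioo (hω : IsRadialWeight ω)
    (hδ : δ ∈ Ico (0 : ℝ) 1) (hK : 1 < K) (hC : 1 < C)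
    (h : ∀ r ∈ Ioo δ 1, C * tail ω (1 - (1 - r) / K) ≤ tail ω r) :
    K ∈ reverseDoublingConstants ω := by
  obtain ⟨D, hD, hD_le⟩ := hω.exists_mul_tail_le_of_le hδ hK
  refine ⟨hK, min C D, lt_min hC hD, fun r hr => ?_⟩
  have hs := one_sub_div_mem_Ico hr.2 hK.le
  have hs_pos := hω.tail_pos ⟨hr.1.le.trans hs.1, hs.2⟩
  rcases le_or_gt r δ with hrδ | hrδ
  · exact (mul_le_mul_of_nonneg_right (min_le_right _ _) hs_pos.le).trans (hD_le r ⟨hr.1.le, hrδ⟩)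
  · exact (mul_le_mul_of_nonneg_right (min_le_left _ _) hs_pos.le).trans (h r ⟨hrδ, hr.2⟩)

theorem IsRegularWeight.exists_density_bounds (hω : IsRegularWeight ω) :
    ∃ C : ℝ, 0 < C ∧ ∃ δ ∈ Ioo (0 : ℝ) 1, ∀ t ∈ Ioo δ 1,
      ω t ≤ C * tail ω t / (1 - t) ∧ tail ω t / (C * (1 - t)) ≤ ω t := by
  obtain ⟨hrad, C, hC, δ, hδ, h⟩ := hω
  refine ⟨C, hC, δ, hδ, fun t ht => ?_⟩
  obtain ⟨h_lower, h_upper⟩ := h t ht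
  have ht1 : 0 < 1 - t := sub_pos.mpr ht.2
  have hpos := hrad.pos t ⟨hδ.1.le.trans ht.1.le, ht.2⟩
  rw [div_lt_div_iff₀ hC (by positivity)] at h_lower
  rw [div_lt_iff₀ (by positivity)] at h_upper
  rw [le_div_iff₀ ht1, div_le_iff₀ (by positivity)]
  constructor <;> linarith

theorem IsRegularWeight.isDoubling (hω : IsRegularWeight ω) : IsDoubling ω := by
  obtain ⟨C, hC, δ, hδ, h⟩ := hω.exists_density_bounds
  have hrad := hω.1
  set k : ℝ := 1 + 1 / (2 * C) with hk
  have hk1 : 1 < k := lt_add_of_pos_right 1 (by positivity)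
  have hstep : ∀ r ∈ Ioo δ 1, tail ω r ≤ 2 * tail ω (1 - (1 - r) / k) := by
    intro r hr
    have hincr := hrad.tail_sub_tail_le_of_density_le hC.le
      (fun t ht => (h t ⟨hr.1.trans_le ht.1, ht.2⟩).1) ⟨hδ.1.le.trans hr.1.le, hr.2⟩ hk1.le
    have hhalf : C * (k - 1) = 1 / 2 := by rw [hk]; field_simp; ring
    rw [hhalf] at hincr
    linarith
  obtain ⟨m, hm⟩ := pow_unbounded_of_one_lt 2 hk1
  refine hrad.isDoubling_of_forall_Ioo (C := 2 ^ m) ⟨hδ.1.le, hδ.2⟩ fun r hr => ?_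
  refine (tail_le_pow_mul_tail hk1.le zero_le_two hstep m r hr).trans ?_
  have hr1 : 0 < 1 - r := sub_pos.mpr hr.2
  have hdiv : (1 - r) / k ^ m ≤ (1 - r) / 2 := by gcongr
  gcongr
  exact hrad.tail_le_tail (by linarith [hδ.1, hr.1]) (by linarith)
    (one_sub_div_mem_Ico hr.2 (one_le_pow₀ hk1.le)).2.le

theorem IsRegularWeight.reverseDoublingConstants_eq (hω : IsRegularWeight ω) :
    reverseDoublingConstants ω = Ioi 1 := by
  obtain ⟨C, hC, δ, hδ, h⟩ := hω.exists_density_bounds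
  refine Subset.antisymm (fun K hK => hK.1) fun K hK => ?_
  have hgain : 0 < (1 - 1 / K) / C :=
    div_pos (sub_pos.mpr ((div_lt_one (one_pos.trans hK)).mpr hK)) hC
  refine hω.1.mem_reverseDoublingConstants_of_forall_Ioo ⟨hδ.1.le, hδ.2⟩ hK
    (lt_add_of_pos_right 1 hgain) fun r hr => ?_
  have hincr := hω.1.mul_tail_le_tail_sub_tail_of_le_density hC
    (fun t ht => (h t ⟨hr.1.trans_le ht.1, ht.2⟩).2) ⟨hδ.1.le.trans hr.1.le, hr.2⟩ (le_of_lt hK)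
  linarith

theorem IsRegularWeight.isTwoSidedDoubling (hω : IsRegularWeight ω) : IsTwoSidedDoubling ω :=
  ⟨hω.isDoubling, hω.1, by rw [hω.reverseDoublingConstants_eq]; exact nonempty_Ioi⟩

theorem IsRegularWeight.infReverseDoubling_eq (hω : IsRegularWeight ω) :
    infReverseDoubling ω = 1 := by
  rw [infReverseDoubling, hω.reverseDoublingConstants_eq, csInf_Ioi]

end Regular

section Polar

open NormedSpace (normalize)

/-- The points of a normed space whose norm lies in `I` and whose direction lies in `Q`. Since
`normalize 0 = 0`, the origin belongs to it when `0 ∈ I` and `0 ∈ Q`. -/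
def polarSector {E : Type*} [NormedAddCommGroup E] [NormedSpace ℝ E] (Q : Set E) (I : Set ℝ) :
    Set E :=
  {z | ‖z‖ ∈ I ∧ normalize z ∈ Q}

theorem integral_volumeIoiPow {F : Type*} [NormedAddCommGroup F] [NormedSpace ℝ F] (d : ℕ)
    (g : ℝ → F) :
    ∫ t : Ioi (0 : ℝ), g t ∂Measure.volumeIoiPow d = ∫ t in Ioi (0 : ℝ), t ^ d • g t := by
  simp only [Measure.volumeIoiPow, ENNReal.ofReal]
  rw [integral_withDensity_eq_integral_smul (measurable_subtype_coe.pow_const _).real_toNNReal,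
    integral_subtype_comap measurableSet_Ioi fun t : ℝ => Real.toNNReal (t ^ d) • g t]
  refine setIntegral_congr_fun measurableSet_Ioi fun t ht => ?_
  rw [NNReal.smul_def, Real.coe_toNNReal _ (pow_nonneg (le_of_lt ht) d)]

variable {E F : Type*} [NormedAddCommGroup E] [NormedSpace ℝ E] [MeasurableSpace E] [BorelSpace E]
  [NormedAddCommGroup F] [NormedSpace ℝ F]

theorem measurable_normalize : Measurable (normalize : E → E) :=
  measurable_norm.inv.smul measurable_id

theorem measurableSet_polarSector {Q : Set E} {I : Set ℝ} (hQ : MeasurableSet Q)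
    (hI : MeasurableSet I) : MeasurableSet (polarSector Q I) :=
  (measurable_norm hI).inter (measurable_normalize hQ)

variable [FiniteDimensional ℝ E] [Nontrivial E] (μ : Measure E) [μ.IsAddHaarMeasure]

theorem integral_normalize_smul_norm (f : E → ℝ) (g : ℝ → F) :
    ∫ z, f (normalize z) • g ‖z‖ ∂μ = (∫ η, f η ∂μ.toSphere) •
      ∫ t in Ioi (0 : ℝ), t ^ (Module.finrank ℝ E - 1) • g t :=
  calc ∫ z, f (normalize z) • g ‖z‖ ∂μ
      = ∫ z : ({0}ᶜ : Set E), f (normalize (z : E)) • g ‖(z : E)‖ ∂(μ.comap Subtype.val) := by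
        rw [integral_subtype_comap (measurableSet_singleton _).compl
          (fun z => f (normalize z) • g ‖z‖), restrict_compl_singleton]
    _ = ∫ p, f p.1 • g p.2 ∂(μ.toSphere.prod (.volumeIoiPow (Module.finrank ℝ E - 1))) := by
        simpa only [NormedSpace.normalize, homeomorphUnitSphereProd_apply_fst_coe,
          homeomorphUnitSphereProd_apply_snd_coe]
          using μ.measurePreserving_homeomorphUnitSphereProd.integral_comp
            (Homeomorph.measurableEmbedding _) (fun p => f p.1 • g p.2)
    _ = (∫ η, f η ∂μ.toSphere) • ∫ t in Ioi (0 : ℝ), t ^ (Module.finrank ℝ E - 1) • g t := by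
        rw [integral_prod_smul (fun η : Metric.sphere (0 : E) 1 => f η)
          (fun t : Ioi (0 : ℝ) => g t), integral_volumeIoiPow]

theorem setIntegral_polarSector {Q : Set E} (hQ : MeasurableSet Q) {I : Set ℝ}
    (hI : MeasurableSet I) (hI0 : I ⊆ Ici 0) (g : ℝ → F) :
    ∫ z in polarSector Q I, g ‖z‖ ∂μ = μ.toSphere.real (Subtype.val ⁻¹' Q) •
      ∫ t in I, t ^ (Module.finrank ℝ E - 1) • g t := by
  have hsplit (z : E) : (polarSector Q I).indicator (fun z => g ‖z‖) z
      = Q.indicator (1 : E → ℝ) (normalize z) • I.indicator g ‖z‖ := by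
    by_cases hQz : normalize z ∈ Q <;> by_cases hIz : ‖z‖ ∈ I <;> simp [polarSector, hQz, hIz]
  have hangular : ∫ η : Metric.sphere (0 : E) 1, Q.indicator (1 : E → ℝ) η ∂μ.toSphere
      = μ.toSphere.real (Subtype.val ⁻¹' Q) :=
    integral_indicator_one (measurable_subtype_coe hQ)
  have hradial : ∫ t in Ioi (0 : ℝ), t ^ (Module.finrank ℝ E - 1) • I.indicator g t
      = ∫ t in I, t ^ (Module.finrank ℝ E - 1) • g t := by
    simp only [← indicator_smul_apply I (fun t : ℝ => t ^ (Module.finrank ℝ E - 1)) g]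
    rw [← integral_Ici_eq_integral_Ioi, setIntegral_indicator hI, inter_eq_right.mpr hI0]
  rw [← integral_indicator (measurableSet_polarSector hQ hI)]
  simp only [hsplit]
  rw [integral_normalize_smul_norm, hangular, hradial]

end Polar

section Moments

variable {ω : ℝ → ℝ} {a b : ℝ}

theorem isRadialWeight_one : IsRadialWeight fun _ => 1 :=
  ⟨fun _ _ => one_pos, integrableOn_const (by simp)⟩

theorem tail_const_one (a : ℝ) : tail (fun _ => 1) a = 1 - a := by
  simp [tail]

theorem IsRadialWeight.integrableOn_pow_mul (hω : IsRadialWeight ω) (d : ℕ) :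
    IntegrableOn (fun t => t ^ d * ω t) (Ico 0 1) := by
  refine hω.integrable.bdd_mul (c := 1) (by fun_prop) ?_
  filter_upwards [ae_restrict_mem measurableSet_Ico] with t ht
  rw [Real.norm_of_nonneg (pow_nonneg ht.1 d)]
  exact pow_le_one₀ ht.1 ht.2.le

theorem IsRadialWeight.setIntegral_Ico (hω : IsRadialWeight ω) (ha : 0 ≤ a) (hab : a ≤ b)
    (hb : b ≤ 1) : ∫ t in Ico a b, ω t = tail ω a - tail ω b := by
  rw [hω.tail_sub_tail ha hab hb, intervalIntegral.integral_of_le hab, integral_Ioc_eq_integral_Ioo,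
    integral_Ico_eq_integral_Ioo]

theorem IsRadialWeight.setIntegral_pow_mul_le (hω : IsRadialWeight ω) (d : ℕ) (ha : 0 ≤ a)
    (hab : a ≤ b) (hb : b ≤ 1) : ∫ t in Ico a b, t ^ d * ω t ≤ tail ω a - tail ω b := by
  have hsub := Ico_subset_Ico ha hb
  rw [← hω.setIntegral_Ico ha hab hb]
  refine setIntegral_mono_on ((hω.integrableOn_pow_mul d).mono_set hsub)
    (hω.integrable.mono_set hsub) measurableSet_Ico fun t ht => ?_
  exact mul_le_of_le_one_left (hω.pos t (hsub ht)).le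
    (pow_le_one₀ (hsub ht).1 (hsub ht).2.le)

theorem IsRadialWeight.pow_mul_le_setIntegral (hω : IsRadialWeight ω) (d : ℕ) (ha : 0 ≤ a)
    (hab : a ≤ b) (hb : b ≤ 1) :
    a ^ d * (tail ω a - tail ω b) ≤ ∫ t in Ico a b, t ^ d * ω t := by
  have hsub := Ico_subset_Ico ha hb
  rw [← hω.setIntegral_Ico ha hab hb, ← integral_const_mul]
  refine setIntegral_mono_on ((hω.integrable.mono_set hsub).const_mul _)
    ((hω.integrableOn_pow_mul d).mono_set hsub) measurableSet_Ico fun t ht => ?_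
  have hpos := hω.pos t (hsub ht)
  have hle := ht.1
  gcongr

end Moments

section Volume

variable {E : Type*} [NormedAddCommGroup E] [NormedSpace ℝ E] [MeasurableSpace E] [BorelSpace E]
  [FiniteDimensional ℝ E] [Nontrivial E] (μ : Measure E) [μ.IsAddHaarMeasure]
  {Q : Set E} {a : ℝ}

theorem measureReal_polarSector_Ico_le (hQ : MeasurableSet Q) (ha : a ∈ Icc (0 : ℝ) 1) :
    μ.real (polarSector Q (Ico a 1)) ≤ μ.toSphere.real (Subtype.val ⁻¹' Q) * (1 - a) := by
  have hradial := isRadialWeight_one.setIntegral_pow_mul_le (Module.finrank ℝ E - 1)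
    ha.1 ha.2 le_rfl
  rw [tail_const_one, tail_const_one, sub_self, sub_zero] at hradial
  rw [← setIntegral_one_eq_measureReal, setIntegral_polarSector μ hQ measurableSet_Ico
    (fun t ht => ha.1.trans ht.1) fun _ => (1 : ℝ)]
  exact mul_le_mul_of_nonneg_left hradial measureReal_nonneg

theorem mul_le_measureReal_polarSector_Ico (hQ : MeasurableSet Q) (ha : a ∈ Icc (0 : ℝ) 1) :
    μ.toSphere.real (Subtype.val ⁻¹' Q) * (a ^ (Module.finrank ℝ E - 1) * (1 - a))
      ≤ μ.real (polarSector Q (Ico a 1)) := by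
  have hradial := isRadialWeight_one.pow_mul_le_setIntegral (Module.finrank ℝ E - 1)
    ha.1 ha.2 le_rfl
  rw [tail_const_one, tail_const_one, sub_self, sub_zero] at hradial
  rw [← setIntegral_one_eq_measureReal (s := polarSector Q (Ico a 1)),
    setIntegral_polarSector μ hQ measurableSet_Ico (fun t ht => ha.1.trans ht.1) fun _ => (1 : ℝ)]
  exact mul_le_mul_of_nonneg_left hradial measureReal_nonneg

end Volume

section Caps

open NormedSpace (normalize)

variable {𝕜 E : Type*} [RCLike 𝕜] [NormedAddCommGroup E] [InnerProductSpace 𝕜 E]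

variable (𝕜) in
/-- The nonisotropic cap `{x | |1 - ⟨ζ, x⟩| ≤ h}`. Its size is the square of the radius of the
corresponding ball for `nonisoDist`. -/
def nonisoCap (ζ : E) (h : ℝ) : Set E := {x | ‖1 - inner 𝕜 ζ x‖ ≤ h}

variable {ζ ξ : E} {h k : ℝ}

theorem nonisoCap_mono (ζ : E) (hhk : h ≤ k) : nonisoCap 𝕜 ζ h ⊆ nonisoCap 𝕜 ζ k :=
  fun _ hx => le_trans (mem_ofPred.mp hx) hhk

theorem closedBall_subset_nonisoCap (hζ : ‖ζ‖ + 1 ≤ h) :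
    Metric.closedBall 0 1 ⊆ nonisoCap 𝕜 ζ h := by
  intro x hx
  rw [mem_closedBall_zero_iff] at hx
  calc ‖1 - inner 𝕜 ζ x‖ ≤ ‖(1 : 𝕜)‖ + ‖inner 𝕜 ζ x‖ := norm_sub_le _ _
    _ ≤ 1 + ‖ζ‖ * ‖x‖ := by rw [norm_one]; gcongr; exact norm_inner_le_norm ζ x
    _ ≤ 1 + ‖ζ‖ := by gcongr; exact mul_le_of_le_one_right (norm_nonneg ζ) hx
    _ ≤ h := by rwa [add_comm]

theorem nonisoCap_inter_closedBall_subset (hζ : ‖ζ‖ ≤ 1) (hξ : ‖ξ‖ ≤ 1) (h : ℝ) :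
    nonisoCap 𝕜 ζ h ∩ Metric.closedBall 0 1
      ⊆ nonisoCap 𝕜 ξ (2 * (‖1 - inner 𝕜 ξ ζ‖ + h)) := by
  rintro x ⟨hx, hx1⟩
  refine (norm_one_sub_inner_le hξ hζ (mem_closedBall_zero_iff.mp hx1)).trans ?_
  gcongr
  exact hx

theorem isClosed_nonisoCap (ζ : E) (h : ℝ) : IsClosed (nonisoCap 𝕜 ζ h) :=
  isClosed_le (by fun_prop) continuous_const

section Sectors

variable [NormedSpace ℝ E] [IsScalarTower ℝ 𝕜 E]

theorem polarSector_nonisoCap_subset (hζ : ‖ζ‖ = 1) (hk : k ≤ h) :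
    polarSector (nonisoCap 𝕜 ζ h) (Ico (1 - k) 1)
      ⊆ Metric.ball 0 1 ∩ nonisoCap 𝕜 ζ (2 * h) := by
  rintro z ⟨⟨hkz, hz1⟩, hz⟩
  refine ⟨mem_ball_zero_iff.mpr hz1, ?_⟩
  have hle := norm_one_sub_inner_le_normalize (𝕜 := 𝕜) hζ.le hz1.le
  rw [NormedSpace.normalize_eq_self_of_norm_eq_one hζ, hζ, one_mul] at hle
  have hzh : ‖1 - inner 𝕜 ζ (normalize z)‖ ≤ h := hz
  exact hle.trans (by linarith)

theorem ball_inter_nonisoCap_subset (hζ : ‖ζ‖ = 1) (h : ℝ) :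
    Metric.ball 0 1 ∩ nonisoCap 𝕜 ζ h
      ⊆ polarSector (nonisoCap 𝕜 ζ (2 * h)) (Ico (1 - h) 1) := by
  rintro z ⟨hz, hzh⟩
  rw [mem_ball_zero_iff] at hz
  have hzh' : ‖1 - inner 𝕜 ζ z‖ ≤ h := hzh
  have hle := norm_one_sub_inner_normalize_le (𝕜 := 𝕜) hζ.le hz.le
  rw [NormedSpace.normalize_eq_self_of_norm_eq_one hζ] at hle
  exact ⟨⟨by linarith [one_sub_norm_right_le (𝕜 := 𝕜) hζ.le z], hz⟩, hle.trans (by linarith)⟩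

end Sectors

variable [MeasurableSpace E]

theorem measurableSet_nonisoCap [BorelSpace E] (ζ : E) (h : ℝ) : MeasurableSet (nonisoCap 𝕜 ζ h) :=
  (isClosed_nonisoCap ζ h).measurableSet

variable [NormedSpace ℝ E] {μ : Measure E}

variable (𝕜 μ) in
/-- The surface measure of the part of a nonisotropic cap on the unit sphere. -/
def capMass (ζ : E) (h : ℝ) : ℝ := μ.toSphere.real (Subtype.val ⁻¹' nonisoCap 𝕜 ζ h)

theorem capMass_nonneg (ζ : E) (h : ℝ) : 0 ≤ capMass 𝕜 μ ζ h := measureReal_nonneg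

theorem capMass_eq_univ (hζ : ‖ζ‖ + 1 ≤ h) : capMass 𝕜 μ ζ h = μ.toSphere.real univ := by
  refine congrArg μ.toSphere.real (eq_univ_of_forall fun x => ?_)
  exact closedBall_subset_nonisoCap hζ (Metric.sphere_subset_closedBall x.2)

variable [BorelSpace E] [FiniteDimensional ℝ E] [μ.IsAddHaarMeasure]

theorem capMass_mono (ζ : E) (hhk : h ≤ k) : capMass 𝕜 μ ζ h ≤ capMass 𝕜 μ ζ k :=
  measureReal_mono (preimage_mono (nonisoCap_mono ζ hhk))

theorem capMass_le_univ (ζ : E) (h : ℝ) : capMass 𝕜 μ ζ h ≤ μ.toSphere.real univ :=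
  measureReal_mono (subset_univ _)

theorem capMass_le_capMass_of_center (hζ : ‖ζ‖ ≤ 1) (hξ : ‖ξ‖ ≤ 1) (h : ℝ) :
    capMass 𝕜 μ ζ h ≤ capMass 𝕜 μ ξ (2 * (‖1 - inner 𝕜 ξ ζ‖ + h)) :=
  measureReal_mono fun x hx =>
    nonisoCap_inter_closedBall_subset (𝕜 := 𝕜) hζ hξ h ⟨hx, Metric.sphere_subset_closedBall x.2⟩

variable [IsScalarTower ℝ 𝕜 E]

theorem pow_mul_measureReal_ball_inter_nonisoCap_le (hζ : ‖ζ‖ = 1) {s : ℝ}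
    (hs : s ∈ Ioc (0 : ℝ) 1) (h : ℝ) :
    s ^ Module.finrank ℝ E * μ.real (Metric.ball 0 1 ∩ nonisoCap 𝕜 ζ h)
      ≤ μ.real (Metric.ball 0 1 ∩ nonisoCap 𝕜 ζ (s * h)) := by
  obtain ⟨hs0, hs1⟩ := hs
  have hsub : AffineMap.homothety ζ s '' (Metric.ball 0 1 ∩ nonisoCap 𝕜 ζ h)
      ⊆ Metric.ball 0 1 ∩ nonisoCap 𝕜 ζ (s * h) := by
    rintro _ ⟨z, ⟨hz, hzh⟩, rfl⟩
    rw [mem_ball_zero_iff] at hz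
    have hval : AffineMap.homothety ζ s z = (1 - s) • ζ + s • z := by
      rw [AffineMap.homothety_apply, vsub_eq_sub, vadd_eq_add]
      module
    rw [hval]
    refine ⟨mem_ball_zero_iff.mpr ?_, ?_⟩
    · calc ‖(1 - s) • ζ + s • z‖ ≤ ‖(1 - s) • ζ‖ + ‖s • z‖ := norm_add_le _ _
        _ = (1 - s) + s * ‖z‖ := by
          rw [norm_smul, norm_smul, hζ, Real.norm_of_nonneg (by linarith),
            Real.norm_of_nonneg hs0.le, mul_one]
        _ < 1 := by nlinarith
    · have hinner : 1 - inner 𝕜 ζ ((1 - s) • ζ + s • z) = s * (1 - inner 𝕜 ζ z) := by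
        rw [inner_add_right, inner_smul_right_eq_smul, inner_smul_right_eq_smul,
          inner_self_eq_norm_sq_to_K, hζ, RCLike.real_smul_eq_coe_mul, RCLike.real_smul_eq_coe_mul]
        push_cast
        ring
      rw [nonisoCap, mem_ofPred, hinner, norm_mul, RCLike.norm_ofReal, abs_of_pos hs0]
      exact mul_le_mul_of_nonneg_left hzh hs0.le
  have himage := measureReal_mono (μ := μ) hsub
    (Metric.isBounded_ball.subset inter_subset_left).measure_lt_top.ne
  rwa [measureReal_def, Measure.addHaar_image_homothety, ENNReal.toReal_mul,
    ENNReal.toReal_ofReal (abs_nonneg _), abs_of_nonneg (pow_nonneg hs0.le _)] at himage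

variable [Nontrivial E]

theorem measureReal_ball_inter_nonisoCap_le (hζ : ‖ζ‖ = 1) (hh : h ∈ Icc (0 : ℝ) 1) :
    μ.real (Metric.ball 0 1 ∩ nonisoCap 𝕜 ζ h) ≤ h * capMass 𝕜 μ ζ (2 * h) := by
  have hsector := measureReal_polarSector_Ico_le μ (measurableSet_nonisoCap (𝕜 := 𝕜) ζ (2 * h))
    (a := 1 - h) ⟨by linarith [hh.2], by linarith [hh.1]⟩
  have hbounded : polarSector (nonisoCap 𝕜 ζ (2 * h)) (Ico (1 - h) 1) ⊆ Metric.ball 0 1 :=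
    fun z hz => mem_ball_zero_iff.mpr hz.1.2
  rw [sub_sub_cancel, ← capMass, mul_comm (capMass _ _ _ _)] at hsector
  exact (measureReal_mono (ball_inter_nonisoCap_subset hζ h)
    (Metric.isBounded_ball.subset hbounded).measure_lt_top.ne).trans hsector

theorem mul_capMass_le_measureReal_ball_inter_nonisoCap (hζ : ‖ζ‖ = 1) (hh : h ∈ Icc (0 : ℝ) 2) :
    (1 / 2) ^ (Module.finrank ℝ E - 1) * (h / 4) * capMass 𝕜 μ ζ h
      ≤ μ.real (Metric.ball 0 1 ∩ nonisoCap 𝕜 ζ (2 * h)) := by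
  obtain ⟨h0, h2⟩ := hh
  have hsector := mul_le_measureReal_polarSector_Ico μ (measurableSet_nonisoCap (𝕜 := 𝕜) ζ h)
    (a := 1 - h / 4) ⟨by linarith, by linarith⟩
  calc (1 / 2) ^ (Module.finrank ℝ E - 1) * (h / 4) * capMass 𝕜 μ ζ h
      ≤ (1 - h / 4) ^ (Module.finrank ℝ E - 1) * (h / 4) * capMass 𝕜 μ ζ h := by
        have := capMass_nonneg (𝕜 := 𝕜) (μ := μ) ζ h
        gcongr
        linarith
    _ ≤ μ.real (polarSector (nonisoCap 𝕜 ζ h) (Ico (1 - h / 4) 1)) := by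
        rwa [sub_sub_cancel, ← capMass, mul_comm] at hsector
    _ ≤ μ.real (Metric.ball 0 1 ∩ nonisoCap 𝕜 ζ (2 * h)) :=
        measureReal_mono (polarSector_nonisoCap_subset hζ (by linarith))
          (Metric.isBounded_ball.subset inter_subset_left).measure_lt_top.ne

theorem mul_capMass_le_mul_capMass (hζ : ‖ζ‖ = 1) {s : ℝ} (hs : s ∈ Ioc (0 : ℝ) (1 / 4))
    (hh : h ∈ Ioc (0 : ℝ) 2) :
    s ^ Module.finrank ℝ E * (1 / 2) ^ (Module.finrank ℝ E - 1) * capMass 𝕜 μ ζ h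
      ≤ 8 * s * capMass 𝕜 μ ζ (4 * s * h) := by
  obtain ⟨h0, h2⟩ := hh
  obtain ⟨hs0, hs4⟩ := hs
  have hsh : s * (2 * h) ∈ Icc (0 : ℝ) 1 := ⟨by positivity, by nlinarith⟩
  refine le_of_mul_le_mul_left ?_ (show 0 < h / 4 by positivity)
  calc h / 4 * (s ^ Module.finrank ℝ E * (1 / 2) ^ (Module.finrank ℝ E - 1) * capMass 𝕜 μ ζ h)
      = s ^ Module.finrank ℝ E *
          ((1 / 2) ^ (Module.finrank ℝ E - 1) * (h / 4) * capMass 𝕜 μ ζ h) := by ring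
    _ ≤ s ^ Module.finrank ℝ E * μ.real (Metric.ball 0 1 ∩ nonisoCap 𝕜 ζ (2 * h)) := by
        gcongr
        exact mul_capMass_le_measureReal_ball_inter_nonisoCap hζ ⟨h0.le, h2⟩
    _ ≤ μ.real (Metric.ball 0 1 ∩ nonisoCap 𝕜 ζ (s * (2 * h))) :=
        pow_mul_measureReal_ball_inter_nonisoCap_le hζ ⟨hs0, by linarith⟩ _
    _ ≤ s * (2 * h) * capMass 𝕜 μ ζ (2 * (s * (2 * h))) :=
        measureReal_ball_inter_nonisoCap_le hζ hsh
    _ = h / 4 * (8 * s * capMass 𝕜 μ ζ (4 * s * h)) := by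
        rw [show 2 * (s * (2 * h)) = 4 * s * h by ring]
        ring

variable (𝕜 μ) in
theorem exists_capMass_le_mul_capMass (B : ℝ) :
    ∃ C : ℝ, ∀ ζ : E, ‖ζ‖ = 1 → ∀ h k : ℝ, 0 < k → h ≤ B * k →
      capMass 𝕜 μ ζ h ≤ C * capMass 𝕜 μ ζ k := by
  set M : ℝ := max B 1
  have hM : 1 ≤ M := le_max_right B 1
  set s : ℝ := 1 / (4 * M)
  have hs : s ∈ Ioc (0 : ℝ) (1 / 4) := by
    refine ⟨by positivity, ?_⟩
    simp only [s]
    gcongr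
    linarith
  set P : ℝ := s ^ Module.finrank ℝ E * (1 / 2) ^ (Module.finrank ℝ E - 1)
  have hP : 0 < P := mul_pos (pow_pos hs.1 _) (by positivity)
  refine ⟨P⁻¹ * (8 * s), fun ζ hζ h k hk hhk => ?_⟩
  have hle : capMass 𝕜 μ ζ h ≤ capMass 𝕜 μ ζ (min (M * k) 2) := by
    rcases min_cases (M * k) 2 with ⟨hmin, -⟩ | ⟨hmin, -⟩ <;> rw [hmin]
    · exact capMass_mono ζ (hhk.trans (by gcongr; exact le_max_left B 1))
    · exact (capMass_le_univ ζ h).trans_eq (capMass_eq_univ (by norm_num [hζ])).symm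
  have hscale : 4 * s * min (M * k) 2 ≤ k :=
    calc 4 * s * min (M * k) 2 ≤ 4 * s * (M * k) := by
          have := hs.1
          gcongr
          exact min_le_left _ _
      _ = k := by simp only [s]; field_simp
  rw [mul_assoc, ← div_eq_inv_mul, le_div_iff₀' hP]
  calc P * capMass 𝕜 μ ζ h ≤ P * capMass 𝕜 μ ζ (min (M * k) 2) := by gcongr
    _ ≤ 8 * s * capMass 𝕜 μ ζ (4 * s * min (M * k) 2) :=
        mul_capMass_le_mul_capMass hζ hs ⟨lt_min (by positivity) two_pos, min_le_right _ _⟩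
    _ ≤ 8 * s * capMass 𝕜 μ ζ k := by
        have := hs.1
        gcongr
        exact capMass_mono ζ hscale

theorem capMass_normalize_isBigO {ι : Type*} {l : Filter ι} {z : ι → E} {h k : ι → ℝ}
    (hk : ∀ᶠ i in l, 0 < k i) (hz : ∀ᶠ i in l, z i = 0 → 1 ≤ k i) (hhk : h =O[l] k) :
    (fun i => capMass 𝕜 μ (normalize (z i)) (h i))
      =O[l] fun i => capMass 𝕜 μ (normalize (z i)) (k i) := by
  obtain ⟨B, hB⟩ := hhk.bound
  obtain ⟨C, hcap⟩ := exists_capMass_le_mul_capMass 𝕜 μ B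
  refine .of_bound (max C 1) ?_
  filter_upwards [hk, hz, hB] with i hki hzi hhi
  rw [Real.norm_of_nonneg (capMass_nonneg _ _), Real.norm_of_nonneg (capMass_nonneg _ _)]
  rw [Real.norm_of_nonneg hki.le] at hhi
  by_cases h0 : z i = 0
  · have huniv : capMass 𝕜 μ (normalize (z i)) (k i) = μ.toSphere.real univ :=
      capMass_eq_univ (by simpa [h0] using hzi h0)
    rw [huniv]
    exact (capMass_le_univ _ _).trans
      (le_mul_of_one_le_left measureReal_nonneg (le_max_right C 1))
  · refine (hcap _ (NormedSpace.norm_normalize h0) _ _ hki ((le_abs_self _).trans hhi)).trans ?_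
    exact mul_le_mul_of_nonneg_right (le_max_left C 1) (capMass_nonneg _ _)

end Caps

section WeightedMass

variable {n : ℕ} {ω : ℝ → ℝ} {s t : Set (Cn n)}

theorem measureReal_unitBall_pos (n : ℕ) : 0 < volume.real (unitBall n) :=
  ENNReal.toReal_pos (Metric.measure_ball_pos volume _ one_pos).ne'
    Metric.isBounded_ball.measure_lt_top.ne

theorem weightedMass_eq (hs : s ⊆ unitBall n) :
    weightedMass ω s = (volume.real (unitBall n))⁻¹ * ∫ z in s, ω ‖z‖ := by
  rw [weightedMass, ballMeasure, Measure.restrict_smul, Measure.restrict_restrict_of_subset hs,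
    integral_smul_measure, ENNReal.toReal_inv, smul_eq_mul, measureReal_def]

theorem IsRadialWeight.ae_nonneg (hω : IsRadialWeight ω) (hs : s ⊆ unitBall n) :
    0 ≤ᵐ[volume.restrict s] fun z => ω ‖z‖ := by
  refine ae_mono (Measure.restrict_mono_set _ hs) ?_
  have hball : MeasurableSet (unitBall n) := measurableSet_ball
  filter_upwards [ae_restrict_mem hball] with z hz
  exact (hω.pos _ ⟨norm_nonneg z, mem_unitBall.mp hz⟩).le

theorem IsRadialWeight.weightedMass_nonneg (hω : IsRadialWeight ω) (hs : s ⊆ unitBall n) :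
    0 ≤ weightedMass ω s := by
  rw [weightedMass_eq hs]
  exact mul_nonneg (inv_nonneg.mpr measureReal_nonneg) (integral_nonneg_of_ae (hω.ae_nonneg hs))

theorem polarSector_subset_unitBall {Q : Set (Cn n)} {a b : ℝ} (hb : b ≤ 1) :
    polarSector Q (Ico a b) ⊆ unitBall n :=
  fun _ hz => mem_unitBall.mpr (hz.1.2.trans_le hb)

variable [Nontrivial (Cn n)]

theorem IsRadialWeight.integrableOn_norm (hω : IsRadialWeight ω) :
    IntegrableOn (fun z : Cn n => ω ‖z‖) (unitBall n) := by
  rw [unitBall, integrableOn_fun_norm_addHaar volume, ← integrableOn_Ico_iff_integrableOn_Ioo]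
  exact hω.integrableOn_pow_mul _

theorem IsRadialWeight.weightedMass_mono (hω : IsRadialWeight ω) (hst : s ⊆ t)
    (ht : t ⊆ unitBall n) : weightedMass ω s ≤ weightedMass ω t := by
  rw [weightedMass_eq (hst.trans ht), weightedMass_eq ht]
  refine mul_le_mul_of_nonneg_left ?_ (inv_nonneg.mpr measureReal_nonneg)
  exact setIntegral_mono_set (hω.integrableOn_norm.mono_set ht) (hω.ae_nonneg ht) hst.eventuallyLE

theorem IsRadialWeight.weightedMass_ball_pos (hω : IsRadialWeight ω) {z : Cn n} {ε : ℝ}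
    (hε : 0 < ε) (hz : Metric.ball z ε ⊆ unitBall n) : 0 < weightedMass ω (Metric.ball z ε) := by
  rw [weightedMass_eq hz]
  refine mul_pos (inv_pos.mpr (measureReal_unitBall_pos n)) ?_
  rw [setIntegral_pos_iff_support_of_nonneg_ae (hω.ae_nonneg hz)
    (hω.integrableOn_norm.mono_set hz)]
  have hsupport : Metric.ball z ε ⊆ Function.support (fun z : Cn n => ω ‖z‖) ∩ Metric.ball z ε :=
    fun w hw => ⟨(hω.pos _ ⟨norm_nonneg w, mem_unitBall.mp (hz hw)⟩).ne', hw⟩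
  exact (Metric.measure_ball_pos volume z hε).trans_le (measure_mono hsupport)

theorem IsRadialWeight.weightedMass_isBigO {ι : Type*} {l : Filter ι} (hω : IsRadialWeight ω)
    {s t : ι → Set (Cn n)} (hst : ∀ᶠ i in l, s i ⊆ t i) (ht : ∀ᶠ i in l, t i ⊆ unitBall n) :
    (fun i => weightedMass ω (s i)) =O[l] fun i => weightedMass ω (t i) := by
  refine .of_bound' ?_
  filter_upwards [hst, ht] with i hsti hti
  rw [Real.norm_of_nonneg (hω.weightedMass_nonneg (hsti.trans hti)),
    Real.norm_of_nonneg (hω.weightedMass_nonneg hti)]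
  exact hω.weightedMass_mono hsti hti

theorem weightedMass_polarSector {Q : Set (Cn n)} (hQ : MeasurableSet Q) {a b : ℝ} (ha : 0 ≤ a)
    (hb : b ≤ 1) : weightedMass ω (polarSector Q (Ico a b)) = (volume.real (unitBall n))⁻¹ *
      (volume.toSphere.real (Subtype.val ⁻¹' Q) *
        ∫ t in Ico a b, t ^ (Module.finrank ℝ (Cn n) - 1) * ω t) := by
  rw [weightedMass_eq (polarSector_subset_unitBall hb),
    setIntegral_polarSector volume hQ measurableSet_Ico (fun t ht => ha.trans ht.1)]
  rfl

section Sectors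

variable {ι : Type*} {l : Filter ι} {Q : ι → Set (Cn n)} {a b : ι → ℝ}

theorem IsRadialWeight.weightedMass_polarSector_isBigO (hω : IsRadialWeight ω)
    (hQ : ∀ i, MeasurableSet (Q i)) (ha : ∀ᶠ i in l, 0 ≤ a i) (hab : ∀ᶠ i in l, a i ≤ b i)
    (hb : ∀ᶠ i in l, b i ≤ 1) :
    (fun i => weightedMass ω (polarSector (Q i) (Ico (a i) (b i)))) =O[l] fun i =>
      volume.toSphere.real (Subtype.val ⁻¹' Q i) * (tail ω (a i) - tail ω (b i)) := by
  refine .of_bound (volume.real (unitBall n))⁻¹ ?_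
  filter_upwards [ha, hab, hb] with i ha hab hb
  have htail : 0 ≤ tail ω (a i) - tail ω (b i) := sub_nonneg.mpr (hω.tail_le_tail ha hab hb)
  rw [Real.norm_of_nonneg (hω.weightedMass_nonneg (polarSector_subset_unitBall hb)),
    Real.norm_of_nonneg (mul_nonneg measureReal_nonneg htail),
    weightedMass_polarSector (hQ i) ha hb]
  gcongr
  exact hω.setIntegral_pow_mul_le _ ha hab hb

theorem IsRadialWeight.isBigO_weightedMass_polarSector (hω : IsRadialWeight ω)
    (hQ : ∀ i, MeasurableSet (Q i)) (ha : ∀ᶠ i in l, 1 / 2 ≤ a i) (hab : ∀ᶠ i in l, a i ≤ b i)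
    (hb : ∀ᶠ i in l, b i ≤ 1) :
    (fun i => volume.toSphere.real (Subtype.val ⁻¹' Q i) * (tail ω (a i) - tail ω (b i)))
      =O[l] fun i => weightedMass ω (polarSector (Q i) (Ico (a i) (b i))) := by
  set d := Module.finrank ℝ (Cn n) - 1
  refine .of_bound (2 ^ d * volume.real (unitBall n)) ?_
  filter_upwards [ha, hab, hb] with i ha hab hb
  have ha0 : 0 ≤ a i := one_half_pos.le.trans ha
  have htail : 0 ≤ tail ω (a i) - tail ω (b i) := sub_nonneg.mpr (hω.tail_le_tail ha0 hab hb)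
  rw [Real.norm_of_nonneg (hω.weightedMass_nonneg (polarSector_subset_unitBall hb)),
    Real.norm_of_nonneg (mul_nonneg measureReal_nonneg htail),
    weightedMass_polarSector (hQ i) ha0 hb, mul_assoc,
    mul_inv_cancel_left₀ (measureReal_unitBall_pos n).ne', mul_left_comm]
  gcongr
  calc tail ω (a i) - tail ω (b i)
      = 2 ^ d * ((1 / 2) ^ d * (tail ω (a i) - tail ω (b i))) := by
        rw [← mul_assoc, ← mul_pow, mul_one_div_cancel two_ne_zero, one_pow, one_mul]
    _ ≤ 2 ^ d * (a i ^ d * (tail ω (a i) - tail ω (b i))) := by gcongr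
    _ ≤ 2 ^ d * ∫ t in Ico (a i) (b i), t ^ d * ω t := by
        gcongr
        exact hω.pow_mul_le_setIntegral d ha0 hab hb

end Sectors

end WeightedMass

section Blocks

open NormedSpace (normalize)

variable {n : ℕ} {ω : ℝ → ℝ} {ι : Type*} {l : Filter ι} {z w : ι → Cn n}

/-- The model for the mass of the blocks at `z`: surface measure of the nonisotropic cap of size
`1 - |z|` around `z / |z|`, times the tail of the weight. -/
def blockSize (ω : ℝ → ℝ) (z : Cn n) : ℝ :=
  capMass ℂ volume (normalize z) (1 - ‖z‖) * tail ω ‖z‖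

theorem blockSize_isBigO [Nontrivial (Cn n)] (hω : IsDoubling ω)
    (hz : ∀ᶠ i in l, z i ∈ unitBall n) (hw : ∀ᶠ i in l, w i ∈ unitBall n)
    (hzw : (fun i => 1 - inner ℂ (z i) (w i)) =O[l] fun i => 1 - ‖w i‖) :
    (fun i => blockSize ω (z i)) =O[l] fun i => blockSize ω (w i) := by
  simp only [mem_unitBall] at hz hw
  have hradii : (fun i => 1 - ‖z i‖) =O[l] fun i => 1 - ‖w i‖ := by
    refine .trans (.of_bound' ?_) hzw
    filter_upwards [hz, hw] with i hz hw
    rw [Real.norm_of_nonneg (sub_nonneg.mpr hz.le)]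
    exact one_sub_norm_left_le (z i) hw.le
  have hcenters : (fun i => 1 - inner ℂ (normalize (w i)) (normalize (z i)))
      =O[l] fun i => 1 - ‖w i‖ := by
    refine .trans (.of_bound 2 ?_) hzw
    filter_upwards [hz, hw] with i hz hw
    rw [norm_one_sub_inner_comm (z i)]
    exact norm_one_sub_inner_normalize_le hw.le hz.le
  have hcaps : (fun i => capMass ℂ volume (normalize (z i)) (1 - ‖z i‖))
      =O[l] fun i => capMass ℂ volume (normalize (w i)) (1 - ‖w i‖) := by
    refine .trans (.of_bound' (.of_forall fun i => ?_)) (capMass_normalize_isBigO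
      (hw.mono fun i => sub_pos.mpr) (.of_forall fun i h0 => by simp [h0])
      ((hcenters.norm_left.add hradii).const_mul_left 2))
    rw [Real.norm_of_nonneg (capMass_nonneg _ _), Real.norm_of_nonneg (capMass_nonneg _ _)]
    exact capMass_le_capMass_of_center (norm_normalize_le_one _) (norm_normalize_le_one _) _
  exact hcaps.mul (hω.tail_isBigO (hz.mono fun i hi => ⟨norm_nonneg _, hi⟩)
    (hw.mono fun i hi => ⟨norm_nonneg _, hi⟩) hradii)

theorem mem_carlesonBlock_iff {a z : Cn n} (ha : a ∈ unitBall n) (ha0 : a ≠ 0) :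
    z ∈ carlesonBlock a ↔
      ‖z‖ ∈ Ioo ‖a‖ 1 ∧ normalize z ∈ nonisoCap ℂ (normalize a) (1 - ‖a‖) := by
  have hsqrt : nonisoDist (normalize a) (normalize z) ≤ √(1 - ‖a‖) ↔
      normalize z ∈ nonisoCap ℂ (normalize a) (1 - ‖a‖) := by
    rw [nonisoDist, Real.sqrt_le_sqrt_iff (sub_nonneg.mpr (mem_unitBall.mp ha).le),
      norm_one_sub_inner_comm, nonisoCap, mem_ofPred]
  rw [carlesonBlock, if_neg ha0, mem_ofPred, mem_unitBall, direction_eq_normalize,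
    direction_eq_normalize, nonisoBall, mem_ofPred, hsqrt, mem_sphere_zero_iff_norm]
  constructor
  · rintro ⟨hz, haz, -, hcap⟩
    exact ⟨⟨haz, hz⟩, hcap⟩
  · rintro ⟨⟨haz, hz⟩, hcap⟩
    have hz0 : z ≠ 0 := norm_pos_iff.mp ((norm_nonneg a).trans_lt haz)
    exact ⟨hz, haz, NormedSpace.norm_normalize hz0, hcap⟩

theorem carlesonBlock_zero : carlesonBlock (0 : Cn n) = unitBall n := if_pos rfl

theorem carlesonBlock_subset_polarSector {a : Cn n} (ha : a ∈ unitBall n) :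
    carlesonBlock a ⊆ polarSector (nonisoCap ℂ (normalize a) (1 - ‖a‖)) (Ico ‖a‖ 1) := by
  intro z hz
  rcases eq_or_ne a 0 with rfl | ha0
  · rw [carlesonBlock_zero, mem_unitBall] at hz
    simp [polarSector, nonisoCap, hz]
  · obtain ⟨hnorm, hcap⟩ := (mem_carlesonBlock_iff ha ha0).mp hz
    exact ⟨Ioo_subset_Ico_self hnorm, hcap⟩

theorem polarSector_subset_carlesonBlock {a : Cn n} (ha : a ∈ unitBall n) {b : ℝ} (hb : ‖a‖ < b) :
    polarSector (nonisoCap ℂ (normalize a) (1 - ‖a‖)) (Ico b 1) ⊆ carlesonBlock a := by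
  rcases eq_or_ne a 0 with rfl | ha0
  · exact carlesonBlock_zero ▸ polarSector_subset_unitBall le_rfl
  · exact fun z hz => (mem_carlesonBlock_iff ha ha0).mpr ⟨⟨hb.trans_le hz.1.1, hz.1.2⟩, hz.2⟩

theorem carlesonBlock_subset_unitBall (a : Cn n) : carlesonBlock a ⊆ unitBall n := by
  rw [carlesonBlock]
  split_ifs
  exacts [subset_rfl, fun z hz => hz.1]

theorem weightedMass_carlesonBlock_isTheta [Nontrivial (Cn n)] (hω : IsDoubling ω) :
    (fun a : Cn n => weightedMass ω (carlesonBlock a)) =Θ[𝓟 (unitBall n)] blockSize ω := by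
  have hcap (a : Cn n) := measurableSet_nonisoCap (𝕜 := ℂ) (normalize a) (1 - ‖a‖)
  have hball : ∀ᶠ a : Cn n in 𝓟 (unitBall n), ‖a‖ < 1 :=
    eventually_principal.mpr fun a => mem_unitBall.mp
  constructor
  · refine (hω.1.weightedMass_isBigO
      (eventually_principal.mpr fun a ha => carlesonBlock_subset_polarSector ha)
      (.of_forall fun a => polarSector_subset_unitBall le_rfl)).trans ?_
    have hsector := hω.1.weightedMass_polarSector_isBigO hcap
      (.of_forall fun a => norm_nonneg a) (hball.mono fun a => le_of_lt)
      (.of_forall fun _ => le_rfl)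
    simp only [tail_one, sub_zero] at hsector
    exact hsector
  · have hsector := hω.1.isBigO_weightedMass_polarSector (l := 𝓟 (unitBall n))
      (a := fun a : Cn n => (1 + ‖a‖) / 2) (b := fun _ => 1) hcap
      (.of_forall fun a => by linarith [norm_nonneg a]) (hball.mono fun a ha => by linarith)
      (.of_forall fun _ => le_rfl)
    simp only [tail_one, sub_zero] at hsector
    have htail : (fun a : Cn n => tail ω ‖a‖) =O[𝓟 (unitBall n)]
        fun a => tail ω ((1 + ‖a‖) / 2) := by
      refine hω.tail_isBigO (hball.mono fun a ha => ⟨norm_nonneg a, ha⟩)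
        (hball.mono fun a ha => ⟨by positivity, by linarith⟩)
        (.of_bound 2 (hball.mono fun a ha => ?_))
      rw [Real.norm_of_nonneg (by linarith), Real.norm_of_nonneg (by linarith)]
      linarith
    refine ((isBigO_refl _ _).mul htail).trans (hsector.trans (hω.1.weightedMass_isBigO
      (eventually_principal.mpr fun a ha => polarSector_subset_carlesonBlock ha ?_)
      (.of_forall carlesonBlock_subset_unitBall)))
    linarith [mem_unitBall.mp ha]

theorem pseudoBall_subset_unitBall (z : Cn n) (r : ℝ) : pseudoBall z r ⊆ unitBall n :=
  fun _ hw => hw.1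

theorem pseudoBall_subset_polarSector {r : ℝ} (hr : r ∈ Ico (0 : ℝ) 1) {z : Cn n}
    (hz : z ∈ unitBall n) : pseudoBall z r ⊆
      polarSector (nonisoCap ℂ (normalize z) (2 * (4 / (1 - r ^ 2) * (1 - ‖z‖))))
        (Ico (max 0 (1 - 4 / (1 - r ^ 2) * (1 - ‖z‖))) 1) := by
  intro w hw
  have hzw := norm_one_sub_inner_le_of_mem_pseudoBall hr hz hw
  have hz1 := (mem_unitBall.mp hz).le
  have hw1 := mem_unitBall.mp hw.1
  refine ⟨⟨max_le (norm_nonneg w) ?_, hw1⟩, ?_⟩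
  · linarith [one_sub_norm_right_le (𝕜 := ℂ) hz1 w]
  · exact (norm_one_sub_inner_normalize_le hz1 hw1.le).trans (by gcongr)

theorem weightedMass_pseudoBall_isBigO [Nontrivial (Cn n)] (hω : IsDoubling ω) {r : ℝ}
    (hr : r ∈ Ico (0 : ℝ) 1) :
    (fun z : Cn n => weightedMass ω (pseudoBall z r)) =O[𝓟 (unitBall n)] blockSize ω := by
  set A : ℝ := 4 / (1 - r ^ 2)
  have hA : 0 < A := div_pos four_pos (by nlinarith [hr.1, hr.2])
  have hball : ∀ᶠ z : Cn n in 𝓟 (unitBall n), 0 < 1 - ‖z‖ :=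
    eventually_principal.mpr fun z hz => sub_pos.mpr (mem_unitBall.mp hz)
  have hlt : ∀ᶠ z : Cn n in 𝓟 (unitBall n), max 0 (1 - A * (1 - ‖z‖)) < 1 :=
    hball.mono fun z hz => max_lt one_pos (by linarith [mul_pos hA hz])
  refine (hω.1.weightedMass_isBigO
    (eventually_principal.mpr fun z hz => pseudoBall_subset_polarSector hr hz)
    (.of_forall fun z => polarSector_subset_unitBall le_rfl)).trans ?_
  refine (hω.1.weightedMass_polarSector_isBigO (fun z => measurableSet_nonisoCap _ _)
    (.of_forall fun z => le_max_left _ _) (hlt.mono fun z => le_of_lt)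
    (.of_forall fun _ => le_rfl)).trans ?_
  simp only [tail_one, sub_zero]
  refine .mul (capMass_normalize_isBigO hball (.of_forall fun z h0 => by simp [h0])
    (((isBigO_refl _ _).const_mul_left A).const_mul_left 2)) ?_
  refine hω.tail_isBigO (hlt.mono fun z hz => ⟨le_max_left _ _, hz⟩)
    (hball.mono fun z hz => ⟨norm_nonneg z, sub_pos.mp hz⟩) (.of_bound A ?_)
  filter_upwards [hball, hlt] with z hz hz1
  rw [Real.norm_of_nonneg (sub_nonneg.mpr hz1.le), Real.norm_of_nonneg hz.le]
  linarith [le_max_right 0 (1 - A * (1 - ‖z‖))]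

end Blocks

section LowerBounds

open NormedSpace (normalize)

variable {n : ℕ} {ω : ℝ → ℝ} {r k : ℝ}

theorem exists_pos_sq_mul_lt (hr : r ∈ Ico (0 : ℝ) 1) (hk : 1 ≤ k)
    (hkr : k < (1 + r) / (1 - r)) : ∃ c > 0, k * c ≤ 1 / 2 ∧
      (1 + c) ^ 2 * (1 + k) ^ 2 * (1 - r ^ 2) < k * ((2 - c) * (2 - k * c)) := by
  obtain ⟨hr0, hr1⟩ := hr
  rw [lt_div_iff₀ (sub_pos.mpr hr1)] at hkr
  have hlimit : (1 + k) ^ 2 * (1 - r ^ 2) < 4 * k := by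
    have hminus : 0 < r * (k + 1) - (k - 1) := by linarith
    have hplus : 0 < r * (k + 1) + (k - 1) := by linarith
    rw [← sub_pos, show 4 * k - (1 + k) ^ 2 * (1 - r ^ 2)
      = (r * (k + 1) - (k - 1)) * (r * (k + 1) + (k - 1)) by ring]
    exact mul_pos hminus hplus
  have hsmall : ∀ᶠ c in nhds (0 : ℝ), k * c < 1 / 2 :=
    ContinuousAt.eventually_lt (by fun_prop) continuousAt_const (by norm_num)
  have hlt : ∀ᶠ c in nhds (0 : ℝ),
      (1 + c) ^ 2 * (1 + k) ^ 2 * (1 - r ^ 2) < k * ((2 - c) * (2 - k * c)) :=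
    ContinuousAt.eventually_lt (by fun_prop) (by fun_prop) (by norm_num; linarith)
  obtain ⟨c, ⟨hc1, hc2⟩, hc0⟩ := (((hsmall.and hlt).filter_mono nhdsWithin_le_nhds).and
    (self_mem_nhdsWithin (s := Ioi (0 : ℝ)))).exists
  exact ⟨c, hc0, hc1.le, hc2⟩

theorem sq_mul_lt_of_le {c q x y s : ℝ} (hs : 0 < s)
    (hc : (1 + c) ^ 2 * (1 + k) ^ 2 * s < k * ((2 - c) * (2 - k * c)))
    (hk : 1 ≤ k) (hkc : k * c ≤ 2) (hx : x ∈ Ioc 0 c) (hy : y ∈ Icc (x / k) (k * x))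
    (hq : 0 ≤ q) (hqxy : q ≤ (1 + c) * (x + y)) :
    q ^ 2 * s < x * (2 - x) * (y * (2 - y)) := by
  obtain ⟨hx0, hxc⟩ := hx
  obtain ⟨hxy, hyx⟩ := hy
  have hk0 : 0 < k := one_pos.trans_le hk
  have hy0 : 0 < y := (div_pos hx0 hk0).trans_le hxy
  have hcomparable : k * (x + y) ^ 2 ≤ (1 + k) ^ 2 * (x * y) := by
    rw [div_le_iff₀' hk0] at hxy
    nlinarith [mul_nonneg (sub_nonneg.mpr hxy) (sub_nonneg.mpr hyx)]
  have hxc2 : 2 - c ≤ 2 - x := by linarith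
  have hyc2 : 2 - k * c ≤ 2 - y := by nlinarith
  have hc2 : 0 ≤ 2 - c := by nlinarith
  have : 0 ≤ 2 - k * c := by linarith
  have hx2 : 0 ≤ 2 - x := hc2.trans hxc2
  refine lt_of_mul_lt_mul_left ?_ hk0.le
  calc k * (q ^ 2 * s) ≤ k * (((1 + c) * (x + y)) ^ 2 * s) := by gcongr
    _ = (1 + c) ^ 2 * s * (k * (x + y) ^ 2) := by ring
    _ ≤ (1 + c) ^ 2 * s * ((1 + k) ^ 2 * (x * y)) := by gcongr
    _ = (1 + c) ^ 2 * (1 + k) ^ 2 * s * (x * y) := by ring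
    _ < k * ((2 - c) * (2 - k * c)) * (x * y) := by gcongr
    _ ≤ k * ((2 - x) * (2 - y)) * (x * y) := by gcongr
    _ = k * (x * (2 - x) * (y * (2 - y))) := by ring

theorem polarSector_subset_pseudoBall (hr : r ∈ Ico (0 : ℝ) 1) (hk : 1 ≤ k) {c : ℝ}
    (hkc : k * c ≤ 1 / 2)
    (hc : (1 + c) ^ 2 * (1 + k) ^ 2 * (1 - r ^ 2) < k * ((2 - c) * (2 - k * c)))
    {z : Cn n} (hz : z ∈ unitBall n) (hzc : 1 - ‖z‖ ≤ c) :
    polarSector (nonisoCap ℂ (normalize z) (c * (1 - ‖z‖)))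
      (Ico (1 - k * (1 - ‖z‖)) (1 - (1 - ‖z‖) / k)) ⊆ pseudoBall z r := by
  rintro w ⟨⟨hlower, hupper⟩, hcap⟩
  replace hcap : ‖1 - inner ℂ (normalize z) (normalize w)‖ ≤ c * (1 - ‖z‖) := hcap
  rw [mem_unitBall] at hz
  have hk0 : 0 < k := one_pos.trans_le hk
  have hr2 : 0 < 1 - r ^ 2 := by nlinarith [hr.1, hr.2]
  have hxk : 0 < (1 - ‖z‖) / k := div_pos (sub_pos.mpr hz) hk0
  have hw : ‖w‖ < 1 := by linarith
  refine (mem_pseudoBall_iff hr.1 (mem_unitBall.mpr hz)).mpr ⟨mem_unitBall.mpr hw, ?_⟩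
  have hq := norm_one_sub_inner_le_normalize (𝕜 := ℂ) hz.le hw.le
  rw [show 1 - ‖z‖ ^ 2 = (1 - ‖z‖) * (2 - (1 - ‖z‖)) by ring,
    show 1 - ‖w‖ ^ 2 = (1 - ‖w‖) * (2 - (1 - ‖w‖)) by ring]
  have hq' : ‖1 - inner ℂ z w‖ ≤ (1 + c) * ((1 - ‖z‖) + (1 - ‖w‖)) := by
    nlinarith
  exact sq_mul_lt_of_le hr2 hc hk (by linarith) ⟨sub_pos.mpr hz, hzc⟩
    ⟨by linarith, by linarith⟩ (norm_nonneg _) hq'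

theorem IsRadialWeight.tail_isBigO_tail_sub_tail (hω : IsRadialWeight ω) (hk : 1 ≤ k)
    (hK : k ^ 2 ∈ reverseDoublingConstants ω) {ι : Type*} {l : Filter ι} {x : ι → ℝ}
    (hx : ∀ᶠ i in l, 0 < x i) (hkx : ∀ᶠ i in l, k * x i < 1) :
    (fun i => tail ω (1 - x i)) =O[l]
      fun i => tail ω (1 - k * x i) - tail ω (1 - x i / k) := by
  obtain ⟨-, M, hM, hrev⟩ := hK
  refine .of_bound (M / (M - 1)) ?_
  filter_upwards [hx, hkx] with i hx hkx
  have hk0 : 0 < k := one_pos.trans_le hk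
  have hxkx : x i ≤ k * x i := le_mul_of_one_le_left hx.le hk
  have hrev := hrev (1 - k * x i) ⟨by linarith, by linarith [mul_pos hk0 hx]⟩
  rw [sub_sub_cancel, show k * x i / k ^ 2 = x i / k by field_simp] at hrev
  have hmono : tail ω (1 - x i) ≤ tail ω (1 - k * x i) :=
    hω.tail_le_tail (by linarith) (by linarith) (by linarith)
  have hpos : 0 < tail ω (1 - x i) := hω.tail_pos ⟨by linarith, by linarith⟩
  have hmul : (M - 1) * tail ω (1 - x i)
      ≤ M * (tail ω (1 - k * x i) - tail ω (1 - x i / k)) := by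
    nlinarith
  have hsub : 0 < tail ω (1 - k * x i) - tail ω (1 - x i / k) :=
    pos_of_mul_pos_right ((mul_pos (sub_pos.mpr hM) hpos).trans_le hmul) (by linarith)
  rw [Real.norm_of_nonneg hpos.le, Real.norm_of_nonneg hsub.le, div_mul_eq_mul_div,
    le_div_iff₀' (sub_pos.mpr hM)]
  exact hmul

variable [Nontrivial (Cn n)]

theorem IsRadialWeight.exists_pos_le_weightedMass_ball (hω : IsRadialWeight ω) {s ε : ℝ}
    (hε : 0 < ε) (hs : s + ε ≤ 1) :
    ∃ c > 0, ∀ z ∈ Metric.closedBall (0 : Cn n) s, c ≤ weightedMass ω (Metric.ball z ε) := by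
  have hball {z : Cn n} (hz : z ∈ Metric.closedBall 0 s) : Metric.ball z ε ⊆ unitBall n :=
    Metric.ball_subset_ball' (by linarith [Metric.mem_closedBall.mp hz])
  refine (isCompact_closedBall (0 : Cn n) s).induction_on
    (p := fun S => ∃ c > 0, ∀ z ∈ S, c ≤ weightedMass ω (Metric.ball z ε))
    ⟨1, one_pos, by simp⟩ ?_ ?_ ?_
  · rintro S T hST ⟨c, hc, hT⟩
    exact ⟨c, hc, fun z hz => hT z (hST hz)⟩
  · rintro S T ⟨c, hc, hS⟩ ⟨d, hd, hT⟩
    refine ⟨min c d, lt_min hc hd, ?_⟩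
    rintro z (hz | hz)
    exacts [(min_le_left c d).trans (hS z hz), (min_le_right c d).trans (hT z hz)]
  · intro x hx
    have hhalf : Metric.ball x (ε / 2) ⊆ unitBall n :=
      (Metric.ball_subset_ball (half_le_self hε.le)).trans (hball hx)
    refine ⟨_, inter_mem_nhdsWithin _ (Metric.ball_mem_nhds x (half_pos hε)), _,
      hω.weightedMass_ball_pos (half_pos hε) hhalf, ?_⟩
    rintro z ⟨hz, hzx⟩
    refine hω.weightedMass_mono (Metric.ball_subset_ball' ?_) (hball hz)
    rw [Metric.mem_ball, dist_comm] at hzx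
    linarith

theorem IsRadialWeight.blockSize_isBigO_closedBall (hω : IsRadialWeight ω)
    (hr : r ∈ Ioc (0 : ℝ) 1) {s : ℝ} (hs : s < 1) :
    blockSize ω =O[𝓟 (Metric.closedBall (0 : Cn n) s)]
      fun z => weightedMass ω (pseudoBall z r) := by
  obtain ⟨hr0, hr1⟩ := hr
  have hupper : blockSize ω =O[𝓟 (Metric.closedBall (0 : Cn n) s)] fun _ => (1 : ℝ) := by
    refine .of_bound (volume.toSphere.real (univ : Set (Metric.sphere (0 : Cn n) 1)) * tail ω 0)
      (eventually_principal.mpr fun z hz => ?_)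
    have hz1 : ‖z‖ < 1 := (mem_closedBall_zero_iff.mp hz).trans_lt hs
    have htail := hω.tail_pos ⟨norm_nonneg z, hz1⟩
    rw [norm_one, mul_one, blockSize,
      Real.norm_of_nonneg (mul_nonneg (capMass_nonneg _ _) htail.le)]
    gcongr
    · exact capMass_le_univ _ _
    · exact hω.tail_le_tail le_rfl (norm_nonneg z) hz1.le
  obtain ⟨c, hc, hlower⟩ := hω.exists_pos_le_weightedMass_ball (n := n) (s := s)
    (ε := r * (1 - s)) (mul_pos hr0 (sub_pos.mpr hs)) (by nlinarith)
  refine hupper.trans (.of_bound c⁻¹ (eventually_principal.mpr fun z hz => ?_))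
  have hzs : ‖z‖ ≤ s := mem_closedBall_zero_iff.mp hz
  have hsub : Metric.ball z (r * (1 - s)) ⊆ pseudoBall z r :=
    (Metric.ball_subset_ball (by gcongr)).trans
      (ball_subset_pseudoBall ⟨hr0.le, hr1⟩ (mem_unitBall.mpr (hzs.trans_lt hs)))
  have hmass := (hlower z hz).trans
    (hω.weightedMass_mono hsub (pseudoBall_subset_unitBall z r))
  rw [norm_one, Real.norm_of_nonneg (hc.le.trans hmass), ← div_eq_inv_mul, one_le_div hc]
  exact hmass

theorem IsRadialWeight.exists_blockSize_isBigO (hω : IsRadialWeight ω) (hr : r ∈ Ico (0 : ℝ) 1)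
    (hk : 1 ≤ k) (hkr : k < (1 + r) / (1 - r)) (hK : k ^ 2 ∈ reverseDoublingConstants ω) :
    ∃ s < 1, blockSize ω =O[𝓟 (unitBall n \ Metric.closedBall 0 s)]
      fun z => weightedMass ω (pseudoBall z r) := by
  obtain ⟨c, hc0, hkc, hc⟩ := exists_pos_sq_mul_lt hr hk hkr
  refine ⟨1 - c, by linarith, ?_⟩
  set l := 𝓟 (unitBall n \ Metric.closedBall 0 (1 - c))
  have hk0 : 0 < k := one_pos.trans_le hk
  have hmem : ∀ᶠ z in l, z ∈ unitBall n ∧ 0 < 1 - ‖z‖ ∧ 1 - ‖z‖ ≤ c := by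
    refine eventually_principal.mpr fun z hz => ⟨hz.1, ?_, ?_⟩
    · exact sub_pos.mpr (mem_unitBall.mp hz.1)
    · linarith [not_le.mp (mt mem_closedBall_zero_iff.mpr hz.2)]
  have hkx : ∀ᶠ z in l, k * (1 - ‖z‖) ≤ 1 / 2 :=
    hmem.mono fun z hz => (mul_le_mul_of_nonneg_left hz.2.2 hk0.le).trans hkc
  have hcap : (fun z => capMass ℂ volume (normalize z) (1 - ‖z‖))
      =O[l] fun z => capMass ℂ volume (normalize z) (c * (1 - ‖z‖)) := by
    refine capMass_normalize_isBigO (hmem.mono fun z hz => mul_pos hc0 hz.2.1) ?_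
      (isBigO_self_const_mul hc0.ne' _ _)
    filter_upwards [hkx] with z hz h0
    rw [h0, norm_zero] at hz
    linarith
  have htail := hω.tail_isBigO_tail_sub_tail hk hK (x := fun z : Cn n => 1 - ‖z‖)
    (hmem.mono fun z hz => hz.2.1) (hkx.mono fun z hz => by linarith)
  simp only [sub_sub_cancel] at htail
  have hsector := hω.isBigO_weightedMass_polarSector (l := l)
    (a := fun z => 1 - k * (1 - ‖z‖)) (b := fun z => 1 - (1 - ‖z‖) / k)
    (fun z => measurableSet_nonisoCap (𝕜 := ℂ) (normalize z) (c * (1 - ‖z‖)))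
    (hkx.mono fun z hz => by linarith)
    (hmem.mono fun z hz => sub_le_sub_left
      ((div_le_self hz.2.1.le hk).trans (le_mul_of_one_le_left hz.2.1.le hk)) 1)
    (hmem.mono fun z hz => sub_le_self 1 (div_nonneg hz.2.1.le hk0.le))
  refine (hcap.mul htail).trans (hsector.trans (hω.weightedMass_isBigO
    (hmem.mono fun z hz => polarSector_subset_pseudoBall hr hk hkc hc hz.1 hz.2.2)
    (.of_forall fun z => pseudoBall_subset_unitBall z r)))

theorem IsTwoSidedDoubling.weightedMass_pseudoBall_isTheta (hω : IsTwoSidedDoubling ω)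
    (hr : r ∈ Ioo (0 : ℝ) 1) (hωr : infReverseDoubling ω < ((1 + r) / (1 - r)) ^ 2) :
    (fun z : Cn n => weightedMass ω (pseudoBall z r)) =Θ[𝓟 (unitBall n)] blockSize ω := by
  refine ⟨weightedMass_pseudoBall_isBigO hω.1 (Ioo_subset_Ico_self hr), ?_⟩
  obtain ⟨K, hK, hKr⟩ := exists_lt_of_csInf_lt hω.2.2 hωr
  have hK1 : 1 ≤ K := hK.1.le
  rw [← Real.sq_sqrt (zero_le_one.trans hK1)] at hK
  obtain ⟨s, hs, hnear⟩ := hω.1.1.exists_blockSize_isBigO (n := n) (Ioo_subset_Ico_self hr)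
    (Real.one_le_sqrt.mpr hK1)
    ((Real.sqrt_lt' (div_pos (by linarith [hr.1]) (sub_pos.mpr hr.2))).mpr hKr) hK
  have hfar := hω.1.1.blockSize_isBigO_closedBall (n := n) (Ioo_subset_Ioc_self hr) hs
  refine (hnear.sup hfar).mono ?_
  rw [sup_principal, sdiff_union_self]
  exact principal_mono.mpr subset_union_left

end LowerBounds

section Comparability

variable {n : ℕ} {ω : ℝ → ℝ} {r : ℝ}

/-- The pairs of points over which `BlocksComparable` asks for uniform constants. -/
def pseudoPairs (n : ℕ) (r : ℝ) : Set (Cn n × Cn n) :=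
  {p | p.1 ∈ unitBall n ∧ p.2 ∈ pseudoBall p.1 r}

theorem blockSize_fst_isTheta_snd [Nontrivial (Cn n)] (hω : IsDoubling ω) (hr : r ∈ Ico (0 : ℝ) 1) :
    (fun p : Cn n × Cn n => blockSize ω p.1) =Θ[𝓟 (pseudoPairs n r)]
      fun p => blockSize ω p.2 := by
  have hfst : ∀ᶠ p in 𝓟 (pseudoPairs n r), p.1 ∈ unitBall n :=
    eventually_principal.mpr fun p hp => hp.1
  have hsnd : ∀ᶠ p in 𝓟 (pseudoPairs n r), p.2 ∈ unitBall n :=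
    eventually_principal.mpr fun p hp => hp.2.1
  constructor
  · refine blockSize_isBigO hω hfst hsnd
      (.of_bound (4 / (1 - r ^ 2)) (eventually_principal.mpr fun p hp => ?_))
    rw [norm_one_sub_inner_comm, Real.norm_of_nonneg (sub_pos.mpr (mem_unitBall.mp hp.2.1)).le]
    exact norm_one_sub_inner_le_of_mem_pseudoBall hr hp.2.1
      ((mem_pseudoBall_comm hr.1 hp.1 hp.2.1).mp hp.2)
  · refine blockSize_isBigO hω hsnd hfst
      (.of_bound (4 / (1 - r ^ 2)) (eventually_principal.mpr fun p hp => ?_))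
    rw [norm_one_sub_inner_comm, Real.norm_of_nonneg (sub_pos.mpr (mem_unitBall.mp hp.1)).le]
    exact norm_one_sub_inner_le_of_mem_pseudoBall hr hp.1 hp.2

theorem isTheta_comp_of_tendsto {α β E F : Type*} [Norm E] [Norm F] {l : Filter α} {l' : Filter β}
    {f : α → E} {g : α → F} (hfg : f =Θ[l] g) {k : β → α} (hk : Tendsto k l' l) :
    (f ∘ k) =Θ[l'] (g ∘ k) :=
  ⟨hfg.1.comp_tendsto hk, hfg.2.comp_tendsto hk⟩

theorem eventually_comparableWith_of_isTheta {α : Type*} {s : Set α} {f g : α → ℝ}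
    (hf : ∀ x ∈ s, 0 ≤ f x) (hg : ∀ x ∈ s, 0 ≤ g x) (hfg : f =Θ[𝓟 s] g) :
    ∀ᶠ C in atTop, ∀ x ∈ s, ComparableWith C (f x) (g x) := by
  obtain ⟨C, hC⟩ := hfg.1.bound
  obtain ⟨D, hD⟩ := hfg.2.bound
  rw [eventually_principal] at hC hD
  filter_upwards [eventually_ge_atTop C, eventually_ge_atTop D] with B hCB hDB x hx
  specialize hC x hx
  specialize hD x hx
  rw [Real.norm_of_nonneg (hf x hx), Real.norm_of_nonneg (hg x hx)] at hC hD
  exact ⟨hC.trans (mul_le_mul_of_nonneg_right hCB (hg x hx)),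
    hD.trans (mul_le_mul_of_nonneg_right hDB (hf x hx))⟩

theorem IsTwoSidedDoubling.blocksComparable [Nontrivial (Cn n)] (hω : IsTwoSidedDoubling ω)
    (hr : r ∈ Ioo (0 : ℝ) 1) (hωr : infReverseDoubling ω < ((1 + r) / (1 - r)) ^ 2) :
    BlocksComparable n ω r := by
  have hfst : Tendsto (Prod.fst : Cn n × Cn n → Cn n) (𝓟 (pseudoPairs n r)) (𝓟 (unitBall n)) :=
    tendsto_principal_principal.mpr fun p hp => hp.1
  have hsnd : Tendsto (Prod.snd : Cn n × Cn n → Cn n) (𝓟 (pseudoPairs n r)) (𝓟 (unitBall n)) :=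
    tendsto_principal_principal.mpr fun p hp => hp.2.1
  have hball := hω.weightedMass_pseudoBall_isTheta (n := n) hr hωr
  have hblock := weightedMass_carlesonBlock_isTheta (n := n) hω.1
  have hsize := blockSize_fst_isTheta_snd (n := n) hω.1 (Ioo_subset_Ico_self hr)
  have hball_fst := isTheta_comp_of_tendsto hball hfst
  have hball_snd := isTheta_comp_of_tendsto hball hsnd
  have hblock_fst := isTheta_comp_of_tendsto hblock hfst
  have hblock_snd := isTheta_comp_of_tendsto hblock hsnd
  have hball_nonneg (z : Cn n) := hω.1.1.weightedMass_nonneg (pseudoBall_subset_unitBall z r)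
  have hblock_nonneg (z : Cn n) := hω.1.1.weightedMass_nonneg (carlesonBlock_subset_unitBall z)
  have hΔΔ := eventually_comparableWith_of_isTheta (fun p _ => hball_nonneg p.1)
    (fun p _ => hball_nonneg p.2) (hball_fst.trans (hsize.trans hball_snd.symm))
  have hΔS := eventually_comparableWith_of_isTheta (fun p _ => hball_nonneg p.2)
    (fun p _ => hblock_nonneg p.1) (hball_snd.trans (hsize.symm.trans hblock_fst.symm))
  have hSS := eventually_comparableWith_of_isTheta (fun p _ => hblock_nonneg p.1)
    (fun p _ => hblock_nonneg p.2) (hblock_fst.trans (hsize.trans hblock_snd.symm))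
  obtain ⟨C, hC, h₁, h₂, h₃⟩ :=
    ((eventually_gt_atTop 0).and (hΔΔ.and (hΔS.and hSS))).exists
  exact ⟨C, hC, fun z hz w hw => ⟨h₁ (z, w) ⟨hz, hw⟩, h₂ (z, w) ⟨hz, hw⟩, h₃ (z, w) ⟨hz, hw⟩⟩⟩

theorem infReverseDoubling_lt_of_one_lt (hω : (reverseDoublingConstants ω).Nonempty)
    (hr : r ∈ Ioo (0 : ℝ) 1) (h : 1 < 1 / infReverseDoubling ω + 2 * r / (1 + r ^ 2)) :
    infReverseDoubling ω < ((1 + r) / (1 - r)) ^ 2 := by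
  have hinf : 1 ≤ infReverseDoubling ω := le_csInf hω fun K hK => hK.1.le
  have hr1 : 0 < 1 - r := sub_pos.mpr hr.2
  have hlt : (1 - r) ^ 2 / (1 + r ^ 2) < 1 / infReverseDoubling ω := by
    have hsub : (1 - r) ^ 2 / (1 + r ^ 2) = 1 - 2 * r / (1 + r ^ 2) := by
      field_simp
      ring
    linarith
  rw [div_lt_div_iff₀ (by positivity) (by positivity), one_mul] at hlt
  rw [div_pow, lt_div_iff₀' (by positivity)]
  nlinarith [hr.1]

theorem one_lt_sq_one_add_div_one_sub (hr : r ∈ Ioo (0 : ℝ) 1) :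
    1 < ((1 + r) / (1 - r)) ^ 2 := by
  refine one_lt_pow₀ ?_ two_ne_zero
  rw [one_lt_div (sub_pos.mpr hr.2)]
  linarith [hr.1]

end Comparability

end BallWeights

end

theorem mainTheorem8_general (n : ℕ) (hn : 1 ≤ n) (ω : ℝ → ℝ) (r : ℝ) (hr : r ∈ Set.Ioo (0 : ℝ) 1)
    (hω : BallWeights.IsTwoSidedDoubling ω)
    (hωr : BallWeights.infReverseDoubling ω < ((1 + r) / (1 - r)) ^ 2) :
    BallWeights.BlocksComparable n ω r := by
  have : NeZero n := ⟨Nat.one_le_iff_ne_zero.mp hn⟩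
  have : Nontrivial (BallWeights.Cn n) := inferInstance
  exact hω.blocksComparable hr hωr

theorem mainTheorem8 (n : ℕ) (hn : 1 ≤ n) (ω : ℝ → ℝ) :
    (∀ r ∈ Set.Ioo (0 : ℝ) 1, BallWeights.IsTwoSidedDoubling ω →
      1 < 1 / BallWeights.infReverseDoubling ω + 2 * r / (1 + r ^ 2) →
      BallWeights.BlocksComparable n ω r) ∧
    (BallWeights.IsRegularWeight ω →
      ∀ r ∈ Set.Ioo (0 : ℝ) 1, BallWeights.BlocksComparable n ω r) := by
  refine ⟨fun r hr hω h => ?_, fun hω r hr => ?_⟩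
  · exact mainTheorem8_general n hn ω r hr hω
      (BallWeights.infReverseDoubling_lt_of_one_lt hω.2.2 hr h)
  · exact mainTheorem8_general n hn ω r hr hω.isTwoSidedDoubling
      (hω.infReverseDoubling_eq ▸ BallWeights.one_lt_sq_one_add_div_one_sub hr)
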